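/- Let $X$ be a connected $D$-dimensional Riemannian manifold (possibly with boundary or corners) with Riemannian distance $d$ and Riemannian volume $m$, let $\mu$ be a Borel probability measure on $X$ with density $h=\frac{d\mu}{dm}$, and let $T:X\to X$ be measure preserving and ergodic with respect to $\mu$. Assume: (A) there are constants $C>0$ and $0<\theta<1$ such that for all bounded Lipschitz functions $f,g:X\to\mathbb R$ and all integers $n\ge 0$ $$\left|\int f\cdot g\circ T^n\,d\mu-\int f\,d\mu\int g\,d\mu\right|\le C\theta^n\|f\|_{\mathrm{Lip}}\|g\|_{\mathrm{Lip}},$$ where $\|f\|_{\mathrm{Lip}}=\sup|f|+\mathrm{Lip}(f)$; (B) there are $r_0>0$ and $0<\delta<1$ such that $\mu\{x: r<d(x,q)<r+\epsilon\}<\epsilon^\delta$ for all $q\in X$ and all $0<\epsilon<r\le r_0$. Let $p\in X$ and $0<\alpha<D$ be such that there are constants $C_1,C_2,r_1>0$ with $C_1 d(x,p)^{-\alpha}\le h(x)\le C_2 d(x,p)^{-\alpha}$ for $m$-almost every $x$ with $0<d(x,p)<r_1$. Let $k\ge D-\alpha$, $\phi(x)=d(x,p)^{-k}$ and $S_n=\sum_{j=0}^{n-1}\phi\circ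 T^j$. Then for every $\epsilon>0$, for $\mu$-almost every $x\in X$, $$\limsup_{n\to\infty}\frac{S_n(x)}{n^{k/(D-\alpha)}(\log n)^{k/(D-\alpha)+\epsilon}}=0 \qquad\text{and}\qquad \liminf_{n\to\infty}\frac{S_n(x)}{n^{k/(D-\alpha)}\left(e^{-(\log n)^{1/2+\epsilon}}\right)^{k/(D-\alpha)}}>1 .$$ Hence, for $\mu$-almost every $x\in X$, $$\lim_{n\to\infty}\frac{\log S_n(x)}{\log n}=\frac{k}{D-\alpha}.$$ -/

import Mathlib

open MeasureTheory Filter Topology Set Bundle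
open scoped Manifold ContDiff

noncomputable section

/-- A bounded Lipschitz real function. -/
def IsBddLipschitz {X : Type*} [MetricSpace X] (f : X → ℝ) : Prop :=
  (∃ M : ℝ, ∀ x, |f x| ≤ M) ∧ ∃ K : ℝ, 0 ≤ K ∧ ∀ x y, |f x - f y| ≤ K * dist x y

/-- The Lipschitz norm `sup |f| + Lip f` of a bounded Lipschitz function. -/
def lipNorm {X : Type*} [MetricSpace X] (f : X → ℝ) : ℝ :=
  (⨆ x, |f x|) + sInf {K : ℝ | 0 ≤ K ∧ ∀ x y, |f x - f y| ≤ K * dist x y}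

/-- Exponential decay of correlations for Lipschitz functions, with constants that do not depend
on the functions. -/
def ExpDecayOfCorrelations {X : Type*} [MetricSpace X] [MeasurableSpace X]
    (T : X → X) (μ : Measure X) : Prop :=
  ∃ C θ : ℝ, 0 < C ∧ 0 < θ ∧ θ < 1 ∧
    ∀ f g : X → ℝ, IsBddLipschitz f → IsBddLipschitz g → ∀ n : ℕ,
      |(∫ x, f x * g (T^[n] x) ∂μ) - (∫ x, f x ∂μ) * (∫ x, g x ∂μ)|
        ≤ C * θ ^ n * lipNorm f * lipNorm g

/-- Thin annuli have small measure, uniformly in their centre. -/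
def ThinAnnuli {X : Type*} [MetricSpace X] [MeasurableSpace X] (μ : Measure X) : Prop :=
  ∃ r₀ δ : ℝ, 0 < r₀ ∧ 0 < δ ∧ δ < 1 ∧
    ∀ (q : X) (ε r : ℝ), 0 < ε → ε < r → r ≤ r₀ →
      μ.real {x | r < dist x q ∧ dist x q < r + ε} < ε ^ δ

/-- `h` is, near `p` and up to `m`-null sets, bounded above and below by positive multiples of
`dist x p ^ (-α)`. -/
def DensityComparableAt {X : Type*} [MetricSpace X] [MeasurableSpace X]
    (m : Measure X) (h : X → ℝ) (p : X) (α : ℝ) : Prop :=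
  ∃ C₁ C₂ r : ℝ, 0 < C₁ ∧ 0 < C₂ ∧ 0 < r ∧
    ∀ᵐ x ∂m, x ≠ p → dist x p < r →
      C₁ * dist x p ^ (-α) ≤ h x ∧ h x ≤ C₂ * dist x p ^ (-α)

/-- The Birkhoff sum `∑_{j < n} φ (T^j x)` of the observable `φ x = dist x p ^ (-k)`. The value
of `φ` at `p` itself is irrelevant for measures that do not charge `p`. -/
def distBirkhoffSum {X : Type*} [MetricSpace X] (T : X → X) (p : X) (k : ℝ) (n : ℕ) (x : X) : ℝ :=
  ∑ j ∈ Finset.range n, dist (T^[j] x) p ^ (-k)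

end

/-! Write `β = D - α` and `s = k / β`, so `s ≥ 1`. Bi-Lipschitz charts give balls of radius `r`
around `p` volume of order `r ^ D`; integrating the density over them gives mass of order `r ^ β`
(`DensityComparableAt.exists_measure_ball_comparable`). Hence `φ` has tail `μ {t ≤ φ} = O(t ^ (-1 /
s))`, and `S_n` should have the size of its largest term, about `n ^ s`.

Upper bound: `φ` itself need not be integrable, but `ψ ∘ φ` is, where `ψ y = y * logWeight s η y` is
roughly `y ^ (1 / s) / (log y) ^ (1 + η)`. As `ψ` is subadditive, `ψ (S_n)` is at most the Birkhoff
sum of `ψ ∘ φ`, which is `O(n)` almost everywhere by the maximal ergodic theorem. Inverting `ψ`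
yields `S_n = O(n ^ s (log n) ^ (s + ε))`.

Lower bound: one close visit to `p` suffices. Decay of correlations, tested on Lipschitz tent
functions, bounds the variance of the number of visits to a small ball. Chebyshev and Borel–Cantelli
along `n = 2 ^ i` then show that almost every orbit comes within `(i ^ 3 / 2 ^ i) ^ (1 / β)` of `p`
before time `2 ^ i` (`ExpDecayOfCorrelations.ae_eventually_exists_dist_lt`). This loses only a power
of `log n`, far less than the factor `exp (-(log n) ^ (1 / 2 + ε))` permits. -/

section

/-! ### Charts are locally bi-Lipschitz for the Riemannian distance -/

open Manifold
open scoped NNReal ENNReal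

attribute [local instance] normedAddCommGroupTangentSpaceVectorSpace
attribute [local instance] normedSpaceTangentSpaceVectorSpace

/-- The inverse of the extended chart at `x` is Lipschitz on the intersection of a small ball with
the range of the model, for the Riemannian distance. -/
theorem exists_riemannianEDist_symm_extChartAt_le
    {E : Type*} [NormedAddCommGroup E] [NormedSpace ℝ E]
    {H : Type*} [TopologicalSpace H] (I : ModelWithCorners ℝ E H)
    {M : Type*} [TopologicalSpace M] [ChartedSpace H M] [IsManifold I 1 M]
    [RiemannianBundle (fun x : M => TangentSpace I x)]
    [IsContinuousRiemannianBundle E (fun x : M => TangentSpace I x)] (x : M) :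
    ∃ C > (0 : ℝ≥0), ∃ r > 0, Metric.ball (extChartAt I x x) r ∩ range I ⊆ (extChartAt I x).target ∧
      ∀ y ∈ Metric.ball (extChartAt I x x) r ∩ range I,
      ∀ z ∈ Metric.ball (extChartAt I x x) r ∩ range I,
        riemannianEDist I ((extChartAt I x).symm y) ((extChartAt I x).symm z) ≤ C * edist y z := by
  rcases eventually_enorm_mfderivWithin_symm_extChartAt_lt I x with ⟨C, C_pos, hC⟩
  obtain ⟨r, r_pos, hr⟩ := Metric.mem_nhdsWithin_iff.1
    (inter_mem (extChartAt_target_mem_nhdsWithin x) hC)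
  refine ⟨C, C_pos, r, r_pos, hr.trans inter_subset_left, fun y hy z hz ↦ ?_⟩
  let η := ContinuousAffineMap.lineMap (R := ℝ) y z
  set γ := (extChartAt I x).symm ∘ η
  -- The ball and the range of the model are both convex, so the segment from `y` to `z` stays where
  -- the derivative of the inverse chart is bounded, even when `x` lies on the boundary or at a
  -- corner.
  have hη := (((convex_ball _ _).inter I.convex_range).segment_subset hy hz).trans hr
  rw [segment_eq_image_lineMap, ← ContinuousAffineMap.coe_lineMap_eq, image_subset_iff] at hη
  simp only [preimage_inter, subset_inter_iff] at hη
  have η_smooth : CMDiff[Icc 0 1] 1 η := by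
    apply ContMDiff.contMDiffOn
    rw [contMDiff_iff_contDiff]
    exact ContinuousAffineMap.contDiff _
  have : riemannianEDist I ((extChartAt I x).symm y) ((extChartAt I x).symm z)
      ≤ pathELength I γ 0 1 := by
    apply riemannianEDist_le_pathELength _ _ _ zero_le_one
    · exact (contMDiffOn_extChartAt_symm x).comp η_smooth hη.1
    · simp [γ, η, ContinuousAffineMap.coe_lineMap_eq]
    · simp [γ, η, ContinuousAffineMap.coe_lineMap_eq]
  apply this.trans
  rw [← lintegral_fderiv_lineMap_eq_edist, pathELength_eq_lintegral_mfderivWithin_Icc,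
    ← lintegral_const_mul' _ _ ENNReal.coe_ne_top]
  apply setLIntegral_mono' measurableSet_Icc (fun t ht ↦ ?_)
  have : mfderiv[Icc 0 1] γ t =
      (mfderiv[range I] (extChartAt I x).symm (η t)) ∘L (mfderiv[Icc 0 1] η t) := by
    apply mfderivWithin_comp
    · exact mdifferentiableWithinAt_extChartAt_symm (hη.1 ht)
    · exact η_smooth.mdifferentiableOn one_ne_zero t ht
    · exact hη.1.trans (preimage_mono (extChartAt_target_subset_range x))
    · rw [uniqueMDiffWithinAt_iff_uniqueDiffWithinAt]
      exact uniqueDiffOn_Icc zero_lt_one t ht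
  have : mfderiv[Icc 0 1] γ t 1 =
      (mfderiv[range I] (extChartAt I x).symm (η t)) (mfderiv[Icc 0 1] η t 1) := congr($this 1)
  rw [this]
  apply (ContinuousLinearMap.le_opENorm _ _).trans
  gcongr
  · exact (hη.2 ht).le
  · simp only [mfderivWithin_eq_fderivWithin]
    exact le_of_eq rfl

/-- The extended chart at `x` is Lipschitz near `x` for the Riemannian distance. -/
theorem exists_edist_extChartAt_le
    {E : Type*} [NormedAddCommGroup E] [NormedSpace ℝ E]
    {H : Type*} [TopologicalSpace H] (I : ModelWithCorners ℝ E H)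
    {M : Type*} [MetricSpace M] [ChartedSpace H M] [IsManifold I 1 M]
    [RiemannianBundle (fun x : M => TangentSpace I x)]
    [IsContinuousRiemannianBundle E (fun x : M => TangentSpace I x)]
    [IsRiemannianManifold I M] (x : M) :
    ∃ C > (0 : ℝ≥0), ∃ r > 0, Metric.ball x r ⊆ (extChartAt I x).source ∧
      ∀ y ∈ Metric.ball x r, ∀ z ∈ Metric.ball x r,
        edist (extChartAt I x y) (extChartAt I x z) ≤ C * edist y z := by
  rcases eventually_enorm_mfderiv_extChartAt_lt I x with ⟨C, C_pos, hC⟩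
  obtain ⟨r, r_pos, hr⟩ :=
    Metric.mem_nhds_iff.1 (inter_mem hC (extChartAt_source_mem_nhds (I := I) x))
  -- Two points of the ball of radius `r / 3` are less than `2 * r / 3` apart, so a nearly minimal
  -- curve joining them stays in the ball of radius `r`, where the derivative bound holds.
  refine ⟨C, C_pos, r / 3, by positivity,
    (Metric.ball_subset_ball (by linarith)).trans (hr.trans inter_subset_right), ?_⟩
  intro y hy z hz
  have hyz : edist y z < ENNReal.ofReal (2 * r / 3) := by
    rw [edist_dist, ENNReal.ofReal_lt_ofReal_iff (by positivity)]
    rw [Metric.mem_ball] at hy hz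
    linarith [dist_triangle_right y z x]
  have key : ∀ b, edist y z < b → b ≤ ENNReal.ofReal (2 * r / 3) →
      edist (extChartAt I x y) (extChartAt I x z) ≤ C * b := by
    intro b hb hbr
    rw [IsRiemannianManifold.out (I := I)] at hb
    rcases exists_lt_of_riemannianEDist_lt hb with ⟨γ, hγy, hγz, γ_smooth, hγ⟩
    have hmem : ∀ t ∈ Icc (0 : ℝ) 1, γ t ∈ Metric.ball x r := by
      intro t ht
      have h1 : riemannianEDist I y (γ t) ≤ pathELength I γ 0 t :=
        riemannianEDist_le_pathELength (γ_smooth.mono (Icc_subset_Icc_right ht.2)) hγy rfl ht.1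
      have h2 : pathELength I γ 0 t ≤ pathELength I γ 0 1 := pathELength_mono le_rfl ht.2
      have h3 : edist y (γ t) < ENNReal.ofReal (2 * r / 3) := by
        rw [IsRiemannianManifold.out (I := I)]
        exact (h1.trans h2).trans_lt (hγ.trans_le hbr)
      rw [edist_dist, ENNReal.ofReal_lt_ofReal_iff (by positivity)] at h3
      rw [Metric.mem_ball] at hy ⊢
      linarith [dist_triangle_left (γ t) x y]
    let γ' := extChartAt I x ∘ γ
    have hC : CMDiff[Icc 0 1] 1 γ' :=
      contMDiffOn_extChartAt.comp (I' := I) (t := (chartAt H x).source)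
        γ_smooth (fun t' ht' ↦ by simpa using (hr (hmem t' ht')).2)
    calc
      edist (extChartAt I x y) (extChartAt I x z)
    _ = ‖γ' 1 - γ' 0‖ₑ := by
      rw [edist_comm, edist_eq_enorm_sub]; simp [γ', hγy, hγz]
    _ ≤ ∫⁻ t' in Icc 0 1, ‖derivWithin γ' (Icc 0 1) t'‖ₑ := by
      apply enorm_sub_le_lintegral_derivWithin_Icc_of_contDiffOn_Icc _ zero_le_one
      rwa [← contMDiffOn_iff_contDiffOn]
    _ = ∫⁻ t' in Icc 0 1, ‖mfderiv[Icc 0 1] γ' t' 1‖ₑ := by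
      simp_rw [← fderivWithin_derivWithin, mfderivWithin_eq_fderivWithin]
      rfl
    _ ≤ ∫⁻ t' in Icc 0 1, C * ‖mfderiv[Icc 0 1] γ t' 1‖ₑ := by
      apply setLIntegral_mono' measurableSet_Icc (fun t' ht' ↦ ?_)
      have : mfderiv[Icc 0 1] γ' t' =
          (mfderiv% (extChartAt I x) (γ t')) ∘L (mfderiv[Icc 0 1] γ t') := by
        apply mfderiv_comp_mfderivWithin
        · exact mdifferentiableAt_extChartAt (by simpa using (hr (hmem t' ht')).2)
        · exact γ_smooth.mdifferentiableOn one_ne_zero _ ht'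
        · rw [uniqueMDiffWithinAt_iff_uniqueDiffWithinAt]
          exact uniqueDiffOn_Icc zero_lt_one _ ht'
      have : mfderiv[Icc 0 1] γ' t' 1 =
          (mfderiv% (extChartAt I x) (γ t')) (mfderiv[Icc 0 1] γ t' 1) :=
        congr($this 1)
      rw [this]
      apply (ContinuousLinearMap.le_opENorm _ _).trans
      gcongr
      exact (hr (hmem t' ht')).1.le
    _ = C * pathELength I γ 0 1 := by
      rw [lintegral_const_mul' _ _ ENNReal.coe_ne_top,
          pathELength_eq_lintegral_mfderivWithin_Icc]
    _ ≤ C * b := by gcongr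
  have hC0 : (C : ℝ≥0∞) ≠ 0 := by exact_mod_cast C_pos.ne'
  refine (ENNReal.div_le_iff_le_mul (.inl hC0) (.inl ENNReal.coe_ne_top)).1
    ?_ |>.trans_eq (mul_comm _ _)
  -- A minimising curve need not exist, so the length bound `b` is allowed to decrease to `edist y
  -- z`.
  refine le_of_forall_gt_imp_ge_of_dense fun b hb ↦ ?_
  rw [ENNReal.div_le_iff_le_mul (.inl hC0) (.inl ENNReal.coe_ne_top), mul_comm]
  exact (key _ (lt_min hb hyz) (min_le_right _ _)).trans (by gcongr; exact min_le_left _ _)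

end

/-! ### Volume of small balls -/

section

open Manifold
open scoped NNReal ENNReal

theorem LipschitzOnWith.euclideanHausdorffMeasure_image_le {X Y : Type*} [EMetricSpace X]
    [MeasurableSpace X] [BorelSpace X] [EMetricSpace Y] [MeasurableSpace Y] [BorelSpace Y]
    {K : ℝ≥0} {f : X → Y} {s : Set X} (h : LipschitzOnWith K f s) (d : ℕ) :
    μHE[d] (f '' s) ≤ (K : ℝ≥0∞) ^ d * μHE[d] s := by
  have := h.hausdorffMeasure_image_le (d := d) (by positivity)
  rw [ENNReal.rpow_natCast] at this
  simp only [Measure.euclideanHausdorffMeasure_def, Measure.smul_apply, ENNReal.smul_def,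
    smul_eq_mul]
  calc _ ≤ _ := mul_le_mul_right this _
    _ = _ := by ring

/-- A convex set with nonempty interior fills at least a fixed proportion of every small ball
centred at one of its points. -/
theorem Convex.exists_le_addHaar_ball_inter {E : Type*} [NormedAddCommGroup E] [NormedSpace ℝ E]
    [FiniteDimensional ℝ E] [MeasurableSpace E] [BorelSpace E] (ν : Measure E)
    [ν.IsAddHaarMeasure] {K : Set E} (hK : Convex ℝ K) (hK' : (interior K).Nonempty) {x : E}
    (hx : x ∈ K) :
    ∃ c > (0 : ℝ), ∀ t, 0 < t → t ≤ 1 →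
      ENNReal.ofReal (c * t ^ Module.finrank ℝ E) ≤ ν (Metric.ball x t ∩ K) := by
  have hpos : 0 < ν (Metric.ball x 1 ∩ K) := by
    have hcl : x ∈ closure (interior K) := by
      rw [hK.closure_interior_eq_closure_of_nonempty_interior hK']
      exact subset_closure hx
    have hne : (Metric.ball x 1 ∩ interior K).Nonempty :=
      mem_closure_iff.1 hcl _ Metric.isOpen_ball (Metric.mem_ball_self one_pos)
    exact ((Metric.isOpen_ball.inter isOpen_interior).measure_pos ν hne).trans_le
      (measure_mono (inter_subset_inter_right _ interior_subset))
  have hfin : ν (Metric.ball x 1 ∩ K) ≠ ⊤ :=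
    ((measure_mono inter_subset_left).trans_lt measure_ball_lt_top).ne
  refine ⟨_, ENNReal.toReal_pos hpos.ne' hfin, fun t ht ht1 ↦ ?_⟩
  -- Shrinking towards `x` by the factor `t` keeps a convex set inside itself and scales Haar
  -- measure by `t` to the dimension; the constant is therefore the measure of the piece in the unit
  -- ball.
  have hsub : AffineMap.homothety x t '' (Metric.ball x 1 ∩ K) ⊆ Metric.ball x t ∩ K := by
    rintro _ ⟨y, ⟨hy, hyK⟩, rfl⟩
    refine ⟨?_, ?_⟩
    · rw [Metric.mem_ball, dist_homothety_center, Real.norm_eq_abs, abs_of_pos ht]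
      rw [Metric.mem_ball, dist_comm] at hy
      nlinarith
    · rw [AffineMap.homothety_eq_lineMap]
      exact hK.lineMap_mem hx hyK ⟨ht.le, ht1⟩
  refine le_trans (le_of_eq ?_) (measure_mono hsub)
  rw [Measure.addHaar_image_homothety, abs_of_pos (by positivity), mul_comm,
    ENNReal.ofReal_mul (by positivity), ENNReal.ofReal_toReal hfin]

/-- In a Riemannian manifold of dimension `D`, the volume of a small ball of radius `r` is
comparable to `r ^ D`. -/
theorem exists_volume_ball_comparable
    {E : Type*} [NormedAddCommGroup E] [NormedSpace ℝ E] [FiniteDimensional ℝ E]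
    {H : Type*} [TopologicalSpace H] (I : ModelWithCorners ℝ E H)
    {M : Type*} [MetricSpace M] [ChartedSpace H M] [IsManifold I 1 M]
    [RiemannianBundle (fun x : M => TangentSpace I x)]
    [IsContinuousRiemannianBundle E (fun x : M => TangentSpace I x)]
    [IsRiemannianManifold I M] [MeasurableSpace M] [BorelSpace M] (p : M) :
    ∃ c C r₀ : ℝ, 0 < c ∧ 0 < C ∧ 0 < r₀ ∧ ∀ r, 0 < r → r ≤ r₀ →
      ENNReal.ofReal (c * r ^ Module.finrank ℝ E) ≤
        μHE[Module.finrank ℝ E] (Metric.ball p r) ∧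
      μHE[Module.finrank ℝ E] (Metric.ball p r) ≤
        ENNReal.ofReal (C * r ^ Module.finrank ℝ E) := by
  borelize E
  set D := Module.finrank ℝ E with hD
  obtain ⟨C₁, hC₁, r₁, hr₁, htarget, hsymm⟩ := exists_riemannianEDist_symm_extChartAt_le I p
  obtain ⟨C₂, hC₂, r₂, hr₂, hsource, hchart⟩ := exists_edist_extChartAt_le I p
  set q := extChartAt I p p with hq
  have hqI : q ∈ range I := extChartAt_target_subset_range p (mem_extChartAt_target p)
  have hL₁ : LipschitzOnWith C₁ (extChartAt I p).symm (Metric.ball q r₁ ∩ range I) := by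
    intro y hy z hz
    rw [IsRiemannianManifold.out (I := I)]
    exact hsymm y hy z hz
  have hL₂ : LipschitzOnWith C₂ (extChartAt I p) (Metric.ball p r₂) :=
    fun y hy z hz ↦ hchart y hy z hz
  have hC₁' : (0 : ℝ) < C₁ := hC₁
  have hC₂' : (0 : ℝ) < C₂ := hC₂
  obtain ⟨c, hc, hball⟩ := I.convex_range.exists_le_addHaar_ball_inter
    (μHE[D] : Measure E) I.nonempty_interior hqI
  set V := ((μHE[D] : Measure E) (Metric.ball 0 1)).toReal with hV
  have hV0 : 0 < V :=
    ENNReal.toReal_pos (Metric.measure_ball_pos _ _ one_pos).ne' measure_ball_lt_top.ne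
  -- The chart maps the `r`-ball onto a set containing the `r / C₁`-ball of the model range and
  -- contained in its `C₂ * r`-ball; transferring Hausdorff measure costs `C₂ ^ D` and `C₁ ^ D`
  -- respectively. The condition `r ≤ C₁` makes the homothety ratio `r / C₁` at most `1`.
  refine ⟨c / (C₁ * C₂) ^ D, (C₁ * C₂) ^ D * V, min (min r₂ (r₁ / C₂)) (min (C₁ * r₁) C₁),
    by positivity, by positivity, by positivity, fun r hr hrle ↦ ⟨?_, ?_⟩⟩
  · have h1 : r ≤ C₁ * r₁ := hrle.trans ((min_le_right _ _).trans (min_le_left _ _))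
    have h2 : r ≤ C₁ := hrle.trans ((min_le_right _ _).trans (min_le_right _ _))
    have h3 : r ≤ r₂ := hrle.trans ((min_le_left _ _).trans (min_le_left _ _))
    have hsub : Metric.ball q (r / C₁) ∩ range I ⊆ extChartAt I p '' Metric.ball p r := by
      rintro y ⟨hy, hyI⟩
      have hr' : r / C₁ ≤ r₁ := by rw [div_le_iff₀ hC₁']; linarith
      have hy1 : y ∈ Metric.ball q r₁ ∩ range I := ⟨Metric.ball_subset_ball hr' hy, hyI⟩
      refine ⟨(extChartAt I p).symm y, ?_, (extChartAt I p).right_inv (htarget hy1)⟩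
      have := hL₁.dist_le_mul y hy1 q ⟨Metric.mem_ball_self hr₁, hqI⟩
      rw [hq, extChartAt_to_inv] at this
      rw [Metric.mem_ball] at hy ⊢
      rw [lt_div_iff₀ hC₁'] at hy
      linarith
    have h4 := (hball (r / C₁) (by positivity) (by rw [div_le_one hC₁']; exact h2)).trans
      ((measure_mono hsub).trans
        ((hL₂.mono (Metric.ball_subset_ball h3)).euclideanHausdorffMeasure_image_le D))
    have h5 : c / (C₁ * C₂) ^ D * r ^ D = (c * (r / C₁) ^ D) / (C₂ : ℝ) ^ D := by
      rw [mul_pow, div_pow]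
      field_simp
    rw [h5, ENNReal.ofReal_div_of_pos (by positivity)]
    refine ENNReal.div_le_of_le_mul' (h4.trans_eq ?_)
    rw [ENNReal.ofReal_pow hC₂'.le, ENNReal.ofReal_coe_nnreal]
  · have h1 : r ≤ r₁ / C₂ := hrle.trans ((min_le_left _ _).trans (min_le_right _ _))
    have h3 : r ≤ r₂ := hrle.trans ((min_le_left _ _).trans (min_le_left _ _))
    have hsub : Metric.ball p r ⊆
        (extChartAt I p).symm '' (Metric.ball q (C₂ * r) ∩ range I) := by
      intro x hx
      have hx2 := Metric.ball_subset_ball h3 hx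
      have hs := hsource hx2
      refine ⟨extChartAt I p x, ⟨?_, extChartAt_target_subset_range p
        ((extChartAt I p).map_source hs)⟩, (extChartAt I p).left_inv hs⟩
      have := hL₂.dist_le_mul x hx2 p (Metric.mem_ball_self hr₂)
      rw [Metric.mem_ball] at hx ⊢
      refine this.trans_lt ?_
      gcongr
    have hsub' : Metric.ball q (C₂ * r) ∩ range I ⊆ Metric.ball q r₁ ∩ range I := by
      refine inter_subset_inter_left _ (Metric.ball_subset_ball ?_)
      rw [le_div_iff₀ hC₂'] at h1
      linarith
    calc μHE[D] (Metric.ball p r)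
        ≤ (C₁ : ℝ≥0∞) ^ D * μHE[D] (Metric.ball q (C₂ * r) ∩ range I) :=
          (measure_mono hsub).trans ((hL₁.mono hsub').euclideanHausdorffMeasure_image_le D)
      _ ≤ (C₁ : ℝ≥0∞) ^ D * μHE[D] (Metric.ball q (C₂ * r)) := by
          gcongr; exact inter_subset_left
      _ = ENNReal.ofReal ((C₁ * C₂) ^ D * V * r ^ D) := by
          rw [Measure.addHaar_ball_of_pos _ _ (by positivity), ← hD,
            ← ENNReal.ofReal_coe_nnreal, ← ENNReal.ofReal_pow hC₁'.le,
            ← ENNReal.ofReal_toReal (measure_ball_lt_top (μ := (μHE[D] : Measure E))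
              (x := 0) (r := 1)).ne, ← ENNReal.ofReal_mul (by positivity),
            ← ENNReal.ofReal_mul (by positivity)]
          congr 1
          rw [← hV]
          ring

end

/-! ### Mass of small balls around the singularity of the density -/

section

open scoped NNReal ENNReal

theorem measure_singleton_eq_zero_of_ball_le {X : Type*} [MetricSpace X] [MeasurableSpace X]
    {m : Measure X} {p : X} {D : ℕ} (hD : D ≠ 0) {C r₀ : ℝ} (hr₀ : 0 < r₀)
    (hm : ∀ r, 0 < r → r ≤ r₀ → m (Metric.ball p r) ≤ ENNReal.ofReal (C * r ^ D)) :
    m {p} = 0 := by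
  have h1 : Tendsto (fun r : ℝ ↦ ENNReal.ofReal (C * r ^ D)) (𝓝[>] 0) (𝓝 0) := by
    have : Tendsto (fun r : ℝ ↦ ENNReal.ofReal (C * r ^ D)) (𝓝 0)
        (𝓝 (ENNReal.ofReal (C * 0 ^ D))) :=
      (ENNReal.continuous_ofReal.comp (by fun_prop)).tendsto 0
    rw [zero_pow hD, mul_zero, ENNReal.ofReal_zero] at this
    exact this.mono_left nhdsWithin_le_nhds
  refine le_antisymm (ge_of_tendsto h1 ?_) zero_le
  filter_upwards [Ioc_mem_nhdsGT hr₀] with r hr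
  exact (measure_mono (by simpa using hr.1)).trans (hm r hr.1 hr.2)

/-- If the volume of balls around `p` behaves like `r ^ D` and the density behaves like
`dist x p ^ (-α)` with `α < D`, the mass of balls around `p` behaves like `r ^ (D - α)`. -/
theorem DensityComparableAt.exists_measure_ball_comparable {X : Type*} [MetricSpace X]
    [MeasurableSpace X] [BorelSpace X] {m : Measure X} {h : X → ℝ} {p : X} {α : ℝ} {D : ℕ}
    (hα : 0 < α) (hαD : α < D) {c C r₀ : ℝ} (hc : 0 < c) (hC : 0 < C) (hr₀ : 0 < r₀)
    (hm : ∀ r, 0 < r → r ≤ r₀ → ENNReal.ofReal (c * r ^ D) ≤ m (Metric.ball p r) ∧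
      m (Metric.ball p r) ≤ ENNReal.ofReal (C * r ^ D))
    (hp : DensityComparableAt m h p α) :
    ∃ c' C' r₁ : ℝ, 0 < c' ∧ 0 < C' ∧ 0 < r₁ ∧ ∀ r, 0 < r → r ≤ r₁ →
      ENNReal.ofReal (c' * r ^ (D - α)) ≤
        m.withDensity (fun x ↦ ENNReal.ofReal (h x)) (Metric.ball p r) ∧
      m.withDensity (fun x ↦ ENNReal.ofReal (h x)) (Metric.ball p r) ≤
        ENNReal.ofReal (C' * r ^ (D - α)) := by
  obtain ⟨C₁, C₂, ρ, hC₁, hC₂, hρ, hdens⟩ := hp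
  have hD0 : D ≠ 0 := by
    rintro rfl
    norm_num at hαD
    linarith
  have hmp : m {p} = 0 := measure_singleton_eq_zero_of_ball_le hD0 hr₀ fun r h1 h2 ↦ (hm r h1 h2).2
  have hne : ∀ᵐ x ∂m, x ≠ p := by
    rw [ae_iff]; simpa using hmp
  set β := (D : ℝ) - α with hβ
  have hβ0 : 0 < β := by rw [hβ]; linarith
  have hpow : ∀ x : ℝ, 0 < x → x ^ (-α) * x ^ D = x ^ β := fun x hx ↦ by
    rw [← Real.rpow_natCast, ← Real.rpow_add hx, hβ]; ring_nf
  set q : ℝ := (1 / 2) ^ β with hq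
  have hq0 : 0 < q := by positivity
  have hq1 : q < 1 := Real.rpow_lt_one (by norm_num) (by norm_num) hβ0
  set B : ℝ := C₂ * (1 / 2) ^ (-α) * (C * 2 ^ D) with hB
  have hB0 : 0 < B := by positivity
  refine ⟨C₁ * c, B / (1 - q), min (r₀ / 2) (ρ / 2), by positivity,
    div_pos hB0 (by linarith), by positivity, fun r hr hrle ↦ ⟨?_, ?_⟩⟩
  · have hrr : r ≤ r₀ := by linarith [min_le_left (r₀ / 2) (ρ / 2)]
    have hrρ : r ≤ ρ := by linarith [min_le_right (r₀ / 2) (ρ / 2)]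
    rw [withDensity_apply _ Metric.isOpen_ball.measurableSet]
    calc ENNReal.ofReal (C₁ * c * r ^ β)
        = ENNReal.ofReal (C₁ * r ^ (-α)) * ENNReal.ofReal (c * r ^ D) := by
          rw [← ENNReal.ofReal_mul (by positivity), ← hpow r hr]; ring_nf
      _ ≤ ENNReal.ofReal (C₁ * r ^ (-α)) * m (Metric.ball p r) := by
          gcongr; exact (hm r hr hrr).1
      _ = ∫⁻ _ in Metric.ball p r, ENNReal.ofReal (C₁ * r ^ (-α)) ∂m := by
          rw [setLIntegral_const]
      _ ≤ _ := by
          refine setLIntegral_mono_ae' Metric.isOpen_ball.measurableSet ?_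
          filter_upwards [hdens, hne] with x hx hxp hxr
          refine ENNReal.ofReal_le_ofReal (le_trans ?_ (hx hxp (lt_of_lt_of_le hxr hrρ)).1)
          have : 0 < dist x p := dist_pos.2 hxp
          gcongr ?_ * ?_
          exact Real.rpow_le_rpow_of_nonpos this (Metric.mem_ball.1 hxr).le (by linarith)
  · have hrr : 2 * r ≤ r₀ := by linarith [min_le_left (r₀ / 2) (ρ / 2)]
    have hrρ : 2 * r ≤ ρ := by linarith [min_le_right (r₀ / 2) (ρ / 2)]
    set ν := m.withDensity (fun x ↦ ENNReal.ofReal (h x)) with hν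
    -- The density is unbounded at `p`, so the upper bound is summed over dyadic annuli: the one at
    -- scale `s` has mass of order `s ^ (-α) * s ^ D = s ^ β`, a geometric series of ratio `q < 1`
    -- because `α < D`.
    let A : ℕ → Set X := fun i ↦ {x | r * (1 / 2) ^ (i + 1) < dist x p} ∩
      {x | dist x p ≤ r * (1 / 2) ^ i}
    have hAm : ∀ i, MeasurableSet (A i) := fun i ↦
      (measurableSet_lt (by fun_prop) (by fun_prop)).inter
        (measurableSet_le (by fun_prop) (by fun_prop))
    have hcover : Metric.ball p r ⊆ {p} ∪ ⋃ i, A i := by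
      intro x hx
      rcases eq_or_ne x p with rfl | hxp
      · simp
      · right
        have hd : 0 < dist x p := dist_pos.2 hxp
        obtain ⟨i, hi1, hi2⟩ := exists_nat_pow_near_of_lt_one (x := dist x p / r)
          (y := 1 / 2) (by positivity) (by rw [div_le_one hr]; exact (Metric.mem_ball.1 hx).le)
          (by norm_num) (by norm_num)
        refine mem_iUnion.2 ⟨i, ?_, ?_⟩
        · rw [lt_div_iff₀ hr] at hi1
          simpa [mul_comm] using hi1
        · rw [div_le_iff₀ hr] at hi2
          simpa [mul_comm] using hi2
    have hAi : ∀ i, ν (A i) ≤ ENNReal.ofReal (B * r ^ β) * ENNReal.ofReal q ^ i := by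
      intro i
      have hs : (0 : ℝ) < r * (1 / 2) ^ i := by positivity
      have hs1 : r * (1 / 2) ^ i ≤ r :=
        mul_le_of_le_one_right hr.le (pow_le_one₀ (by norm_num) (by norm_num))
      set s := r * (1 / 2) ^ i with hsdef
      -- The annulus includes its outer sphere, hence the larger open ball; the halved radii in the
      -- choice of `r₁` leave room for it.
      have hAsub : A i ⊆ Metric.ball p (2 * s) := fun x hx ↦ by
        have := hx.2
        simp only [mem_ofPred_eq] at this
        rw [Metric.mem_ball]; linarith
      rw [hν, withDensity_apply _ (hAm i)]
      calc ∫⁻ x in A i, ENNReal.ofReal (h x) ∂m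
          ≤ ∫⁻ _ in A i, ENNReal.ofReal (C₂ * (s * (1 / 2)) ^ (-α)) ∂m := by
            refine setLIntegral_mono_ae' (hAm i) ?_
            filter_upwards [hdens, hne] with x hx hxp hxA
            have hxρ : dist x p < ρ := by
              have := Metric.mem_ball.1 (hAsub hxA)
              linarith
            refine ENNReal.ofReal_le_ofReal ((hx hxp hxρ).2.trans ?_)
            gcongr ?_ * ?_
            refine Real.rpow_le_rpow_of_nonpos (by positivity) ?_ (by linarith)
            have := hxA.1
            simp only [mem_ofPred_eq, pow_succ] at this
            rw [hsdef]; linarith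
        _ = ENNReal.ofReal (C₂ * (s * (1 / 2)) ^ (-α)) * m (A i) := setLIntegral_const _ _
        _ ≤ ENNReal.ofReal (C₂ * (s * (1 / 2)) ^ (-α)) * ENNReal.ofReal (C * (2 * s) ^ D) := by
            gcongr
            exact (measure_mono hAsub).trans (hm _ (by positivity) (by linarith)).2
        _ = ENNReal.ofReal (B * r ^ β) * ENNReal.ofReal q ^ i := by
            rw [← ENNReal.ofReal_mul (by positivity), ← ENNReal.ofReal_pow hq0.le,
              ← ENNReal.ofReal_mul (by positivity)]
            congr 1
            have h1 : s ^ β = r ^ β * q ^ i := by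
              rw [hsdef, Real.mul_rpow hr.le (by positivity), hq, ← Real.rpow_natCast,
                ← Real.rpow_natCast, ← Real.rpow_mul (by norm_num), ← Real.rpow_mul (by norm_num),
                mul_comm (i : ℝ)]
            rw [Real.mul_rpow hs.le (by norm_num), mul_pow, mul_assoc B, ← h1, ← hpow s hs, hB]
            ring
    calc ν (Metric.ball p r) ≤ ν {p} + ν (⋃ i, A i) :=
          (measure_mono hcover).trans (measure_union_le _ _)
      _ ≤ 0 + ∑' i, ν (A i) := by
          gcongr
          · exact (withDensity_absolutelyContinuous _ _ hmp).le
          · exact measure_iUnion_le _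
      _ ≤ ∑' i, ENNReal.ofReal (B * r ^ β) * ENNReal.ofReal q ^ i := by
          rw [zero_add]; exact ENNReal.tsum_le_tsum hAi
      _ = ENNReal.ofReal (B / (1 - q) * r ^ β) := by
          rw [ENNReal.tsum_mul_left, ENNReal.tsum_geometric, ← ENNReal.ofReal_one,
            ← ENNReal.ofReal_sub _ hq0.le, ← ENNReal.ofReal_inv_of_pos (by linarith),
            ← ENNReal.ofReal_mul (by positivity)]
          congr 1
          ring

end

/-! ### Maximal ergodic theorem and linear growth of Birkhoff sums -/

section

open scoped NNReal ENNReal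

/-- The running maximum `max (0, f, f + f ∘ T, …)` of the Birkhoff sums of length at most `n`. -/
def maxBirkhoffSum {X : Type*} (T : X → X) (f : X → ℝ) : ℕ → X → ℝ
  | 0 => fun _ ↦ 0
  | n + 1 => fun x ↦ max 0 (f x + maxBirkhoffSum T f n (T x))

theorem maxBirkhoffSum_nonneg {X : Type*} (T : X → X) (f : X → ℝ) (n : ℕ) (x : X) :
    0 ≤ maxBirkhoffSum T f n x := by
  cases n with
  | zero => exact le_rfl
  | succ n => exact le_max_left _ _

theorem maxBirkhoffSum_le_succ {X : Type*} (T : X → X) (f : X → ℝ) (n : ℕ) (x : X) :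
    maxBirkhoffSum T f n x ≤ maxBirkhoffSum T f (n + 1) x := by
  induction n generalizing x with
  | zero => exact le_max_left _ _
  | succ n ih => exact max_le_max le_rfl (by gcongr; exact ih _)

theorem birkhoffSum_le_maxBirkhoffSum {X : Type*} (T : X → X) (f : X → ℝ) {n m : ℕ} (hnm : n ≤ m)
    (x : X) : birkhoffSum T f n x ≤ maxBirkhoffSum T f m x := by
  induction m generalizing n x with
  | zero =>
    obtain rfl : n = 0 := by omega
    simp [maxBirkhoffSum]
  | succ m ih =>
    cases n with
    | zero => simpa using maxBirkhoffSum_nonneg T f (m + 1) x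
    | succ n =>
      rw [birkhoffSum_succ']
      exact le_max_of_le_right (by gcongr; exact ih (by omega) _)

theorem measurable_maxBirkhoffSum {X : Type*} [MeasurableSpace X] {T : X → X} (hT : Measurable T)
    {f : X → ℝ} (hf : Measurable f) (n : ℕ) : Measurable (maxBirkhoffSum T f n) := by
  induction n with
  | zero => exact measurable_const
  | succ n ih => exact measurable_const.max (hf.add (ih.comp hT))

theorem MeasureTheory.MeasurePreserving.integrable_maxBirkhoffSum {X : Type*} [MeasurableSpace X]
    {μ : Measure X} {T : X → X} (hT : MeasurePreserving T μ μ) {f : X → ℝ} (hf : Integrable f μ)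
    (n : ℕ) : Integrable (maxBirkhoffSum T f n) μ := by
  induction n with
  | zero => exact integrable_zero _ _ _
  | succ n ih => exact (integrable_zero _ _ _).sup (hf.add (hT.integrable_comp_of_integrable ih))

/-- The maximal ergodic theorem. -/
theorem MeasureTheory.MeasurePreserving.setIntegral_maxBirkhoffSum_pos_nonneg {X : Type*}
    [MeasurableSpace X] {μ : Measure X} {T : X → X} (hT : MeasurePreserving T μ μ) {f : X → ℝ}
    (hf : Integrable f μ) (hfm : Measurable f) (n : ℕ) :
    0 ≤ ∫ x in {x | 0 < maxBirkhoffSum T f n x}, f x ∂μ := by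
  cases n with
  | zero => simp [maxBirkhoffSum]
  | succ n =>
    set M := maxBirkhoffSum T f (n + 1) with hM
    have hMm : Measurable M := measurable_maxBirkhoffSum hT.measurable hfm _
    have hMi : Integrable M μ := hT.integrable_maxBirkhoffSum hf _
    have hA : MeasurableSet {x | 0 < M x} := measurableSet_lt measurable_const hMm
    rw [← integral_indicator hA]
    have hMT : Integrable (fun x ↦ M (T x)) μ := hT.integrable_comp_of_integrable hMi
    have h0 : ∫ x, (M x - M (T x)) ∂μ = 0 := by
      rw [integral_sub hMi hMT, sub_eq_zero]
      rw [← integral_map hT.measurable.aemeasurable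
        (hMm.aestronglyMeasurable), hT.map_eq]
    -- Garsia's argument: `M - M ∘ T` has integral zero by invariance. It is at most `f` where `M >
    -- 0`, and at most `0` elsewhere, since there `M = 0 ≤ M ∘ T`.
    refine h0.ge.trans (integral_mono (hMi.sub hMT) (hf.indicator hA) ?_)
    intro x
    by_cases hx : 0 < M x
    · have h1 : M x = f x + maxBirkhoffSum T f n (T x) := by
        have h2 : M x = max 0 (f x + maxBirkhoffSum T f n (T x)) := rfl
        rcases max_choice 0 (f x + maxBirkhoffSum T f n (T x)) with h3 | h3
        · rw [h2, h3] at hx; exact absurd hx (lt_irrefl _)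
        · rw [h2, h3]
      have h4 := maxBirkhoffSum_le_succ T f n (T x)
      rw [indicator_of_mem (by exact hx)]
      show M x - M (T x) ≤ f x
      rw [hM] at h1 ⊢
      linarith
    · rw [indicator_of_notMem (by exact hx)]
      show M x - M (T x) ≤ 0
      have := maxBirkhoffSum_nonneg T f (n + 1) (T x)
      rw [← hM] at this
      linarith

/-- Birkhoff sums of an integrable function grow at most linearly, almost everywhere. -/
theorem MeasureTheory.MeasurePreserving.ae_exists_birkhoffSum_le {X : Type*}
    [MeasurableSpace X] {μ : Measure X} [IsFiniteMeasure μ] {T : X → X}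
    (hT : MeasurePreserving T μ μ) {g : X → ℝ} (hg : Integrable g μ) (hgm : Measurable g) :
    ∀ᵐ x ∂μ, ∃ K : ℝ, ∀ n : ℕ, birkhoffSum T g n x ≤ K * n := by
  have key : ∀ L : ℝ, 0 < L → μ {x | ∃ n : ℕ, L * n < birkhoffSum T g n x} ≤
      ENNReal.ofReal ((∫ x, |g x| ∂μ) / L) := by
    intro L hL
    -- The maximal theorem for `g - L` says `L * μ (A N) ≤ ∫ g` over `A N`, which is a weak-type
    -- bound; letting `L` grow makes the exceptional set null.
    set f : X → ℝ := fun x ↦ g x - L with hf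
    have hfi : Integrable f μ := hg.sub (integrable_const L)
    have hfm : Measurable f := hgm.sub measurable_const
    have hsum : ∀ n x, birkhoffSum T f n x = birkhoffSum T g n x - L * n := by
      intro n x
      simp [birkhoffSum, hf, mul_comm]
    set A : ℕ → Set X := fun N ↦ {x | 0 < maxBirkhoffSum T f N x} with hAdef
    have hA : ∀ N, MeasurableSet (A N) := fun N ↦
      measurableSet_lt measurable_const (measurable_maxBirkhoffSum hT.measurable hfm _)
    have hmono : Monotone A := monotone_nat_of_le_succ fun N x hx ↦
      lt_of_lt_of_le (show 0 < maxBirkhoffSum T f N x from hx) (maxBirkhoffSum_le_succ T f N x)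
    have hAle : ∀ N, μ (A N) ≤ ENNReal.ofReal ((∫ x, |g x| ∂μ) / L) := by
      intro N
      have h1 := hT.setIntegral_maxBirkhoffSum_pos_nonneg hfi hfm N
      rw [show (fun x ↦ f x) = fun x ↦ g x - L from rfl] at h1
      rw [integral_sub hg.integrableOn (integrable_const L).integrableOn, setIntegral_const,
        smul_eq_mul, sub_nonneg] at h1
      have h2 : ∫ x in A N, g x ∂μ ≤ ∫ x, |g x| ∂μ :=
        (integral_mono hg.integrableOn hg.abs.integrableOn fun x ↦ le_abs_self _).trans
          (setIntegral_le_integral hg.abs (ae_of_all _ fun x ↦ abs_nonneg _))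
      rw [← ENNReal.ofReal_toReal (measure_ne_top μ (A N))]
      refine ENNReal.ofReal_le_ofReal ?_
      rw [le_div_iff₀ hL]
      exact h1.trans h2
    calc μ {x | ∃ n : ℕ, L * n < birkhoffSum T g n x} ≤ μ (⋃ N, A N) := by
          refine measure_mono ?_
          rintro x ⟨n, hn⟩
          refine mem_iUnion.2 ⟨n, lt_of_lt_of_le ?_ (birkhoffSum_le_maxBirkhoffSum T f le_rfl x)⟩
          rw [hsum]; linarith
      _ ≤ _ := by
          rw [hmono.measure_iUnion]
          exact iSup_le hAle
  rw [ae_iff]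
  have hlim : Tendsto (fun N : ℕ ↦ ENNReal.ofReal ((∫ x, |g x| ∂μ) / ((N : ℝ) + 1))) atTop
      (𝓝 0) := by
    rw [← ENNReal.ofReal_zero]
    refine ENNReal.tendsto_ofReal ?_
    exact tendsto_const_nhds.div_atTop
      (tendsto_atTop_add_const_right _ _ tendsto_natCast_atTop_atTop)
  refine le_antisymm (ge_of_tendsto' hlim fun N ↦ ?_) zero_le
  refine (measure_mono ?_).trans (key _ (by positivity))
  intro x hx
  simp only [mem_ofPred_eq, not_exists, not_forall, not_le] at hx ⊢
  exact hx _

end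

/-! ### Upper bound: a subadditive transform of a non-integrable observable -/

section

open scoped NNReal ENNReal

/-- A decreasing weight; `y * logWeight s η y` is a subadditive function of `y` that is slightly
smaller than `y ^ (1 / s)`. -/
noncomputable def logWeight (s η y : ℝ) : ℝ :=
  (1 + y) ^ (1 / s - 1) * (1 + Real.log (1 + y)) ^ (-(1 + η))

theorem logWeight_nonneg {s η y : ℝ} (hy : 0 ≤ y) : 0 ≤ logWeight s η y := by
  have := Real.log_nonneg (by linarith : 1 ≤ 1 + y)
  exact mul_nonneg (Real.rpow_nonneg (by linarith) _) (Real.rpow_nonneg (by linarith) _)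

theorem measurable_logWeight (s η : ℝ) : Measurable (logWeight s η) := by
  unfold logWeight
  fun_prop

theorem logWeight_antitone {s η x y : ℝ} (hs : 1 ≤ s) (hη : 0 < η) (hx : 0 ≤ x) (hxy : x ≤ y) :
    logWeight s η y ≤ logWeight s η x := by
  have hlx := Real.log_nonneg (by linarith : 1 ≤ 1 + x)
  have hl : Real.log (1 + x) ≤ Real.log (1 + y) := Real.log_le_log (by linarith) (by linarith)
  have hs' : 1 / s - 1 ≤ 0 := by
    rw [sub_nonpos, div_le_one (by linarith)]; exact hs
  refine mul_le_mul ?_ ?_ (Real.rpow_nonneg (by linarith) _) (Real.rpow_nonneg (by linarith) _)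
  · exact Real.rpow_le_rpow_of_nonpos (by linarith) (by linarith) hs'
  · exact Real.rpow_le_rpow_of_nonpos (by linarith) (by linarith) (by linarith)

/-- Each summand is at most the whole sum, and the weight is decreasing. This is the subadditivity
that replaces a Birkhoff sum of `φ` by one of an integrable function. -/
theorem sum_mul_logWeight_sum_le {s η : ℝ} (hs : 1 ≤ s) (hη : 0 < η) {ι : Type*} (t : Finset ι)
    (y : ι → ℝ) (hy : ∀ i, 0 ≤ y i) :
    (∑ i ∈ t, y i) * logWeight s η (∑ i ∈ t, y i) ≤ ∑ i ∈ t, y i * logWeight s η (y i) := by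
  rw [Finset.sum_mul]
  refine Finset.sum_le_sum fun i hi ↦ mul_le_mul_of_nonneg_left ?_ (hy i)
  exact logWeight_antitone hs hη (hy i) (Finset.single_le_sum (fun j _ ↦ hy j) hi)

/-- On the level `2 ^ i ≤ 1 + φ < 2 ^ (i + 1)` the integrand is at most `c i`, and the powers of `2
^ i` in `c i` and in the tail cancel. What remains is `(i + 1) ^ (-(1 + η))`, summable thanks to the
extra `η`. -/
theorem integrable_mul_logWeight {X : Type*} [MeasurableSpace X] {μ : Measure X}
    [IsProbabilityMeasure μ] {s η C : ℝ} (hs : 1 ≤ s) (hη : 0 < η) (hC : 0 ≤ C) {φ : X → ℝ}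
    (hφ : Measurable φ) (hφ0 : ∀ x, 0 ≤ φ x)
    (htail : ∀ t, 0 < t → μ {x | t ≤ φ x} ≤ ENNReal.ofReal (C * t ^ (-(1 / s)))) :
    Integrable (fun x ↦ φ x * logWeight s η (φ x)) μ := by
  refine ⟨(hφ.mul ((measurable_logWeight s η).comp hφ)).aestronglyMeasurable, ?_⟩
  rw [hasFiniteIntegral_iff_ofReal (ae_of_all _ fun x ↦
    mul_nonneg (hφ0 x) (logWeight_nonneg (hφ0 x)))]
  have hs0 : 0 < s := by linarith
  have hl2 : 0 < Real.log 2 := Real.log_pos (by norm_num)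
  have hl2' : Real.log 2 ≤ 1 := by linarith [Real.log_two_lt_d9]
  let c : ℕ → ℝ := fun i ↦ ((2 : ℝ) ^ (i + 1)) ^ (1 / s) * (Real.log 2 * (i + 1)) ^ (-(1 + η))
  have hc0 : ∀ i, 0 ≤ c i := fun i ↦ by positivity
  let A : ℕ → Set X := fun i ↦ {x | (2 : ℝ) ^ i ≤ 1 + φ x}
  have hA : ∀ i, MeasurableSet (A i) := fun i ↦
    measurableSet_le measurable_const (measurable_const.add hφ)
  -- For `i ≥ 1`, `2 ^ i ≤ 1 + φ` forces `φ ≥ 2 ^ i / 2`, which costs `2 ^ (1 / s)`; the `+ 1`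
  -- handles `i = 0`, where only the trivial bound by `1` is available.
  set C' : ℝ := C * 2 ^ (1 / s) + 1 with hC'
  have hC'0 : 0 < C' := by positivity
  have hμA : ∀ i, μ (A i) ≤ ENNReal.ofReal (C' * ((2 : ℝ) ^ i) ^ (-(1 / s))) := by
    intro i
    rcases Nat.eq_zero_or_pos i with rfl | hi
    · rw [pow_zero, Real.one_rpow, mul_one]
      refine prob_le_one.trans ?_
      rw [← ENNReal.ofReal_one]
      refine ENNReal.ofReal_le_ofReal ?_
      have : 0 ≤ C * 2 ^ (1 / s) := by positivity
      linarith
    · have h2 : (2 : ℝ) ≤ 2 ^ i := by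
        simpa using pow_le_pow_right₀ (by norm_num : (1 : ℝ) ≤ 2) hi
      refine (measure_mono ?_).trans ((htail ((2 : ℝ) ^ i / 2) (by positivity)).trans
        (ENNReal.ofReal_le_ofReal ?_))
      · intro x hx
        have : (2 : ℝ) ^ i ≤ 1 + φ x := hx
        simp only [mem_ofPred_eq]
        linarith
      · rw [Real.div_rpow (by positivity) (by norm_num), Real.rpow_neg (by norm_num : (0:ℝ) ≤ 2),
          div_inv_eq_mul]
        have : 0 ≤ ((2 : ℝ) ^ i) ^ (-(1 / s)) := by positivity
        rw [hC']
        nlinarith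
  have hpt : ∀ x, ENNReal.ofReal (φ x * logWeight s η (φ x)) ≤
      ∑' i, (A i).indicator (fun _ ↦ ENNReal.ofReal (c i)) x := by
    intro x
    obtain ⟨i, hi1, hi2⟩ := exists_nat_pow_near (x := 1 + φ x) (y := 2) (by linarith [hφ0 x])
      (by norm_num)
    refine le_trans ?_ (ENNReal.le_tsum i)
    rw [indicator_of_mem (by exact hi1)]
    refine ENNReal.ofReal_le_ofReal ?_
    have hY : 0 < 1 + φ x := by linarith [hφ0 x]
    have hlog : Real.log 2 * (i + 1) ≤ 1 + Real.log (1 + φ x) := by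
      have : Real.log ((2 : ℝ) ^ i) ≤ Real.log (1 + φ x) := Real.log_le_log (by positivity) hi1
      rw [Real.log_pow] at this
      linarith
    calc φ x * logWeight s η (φ x) ≤ (1 + φ x) * logWeight s η (φ x) := by
          refine mul_le_mul_of_nonneg_right (by linarith) (logWeight_nonneg (hφ0 x))
      _ = (1 + φ x) ^ (1 / s) * (1 + Real.log (1 + φ x)) ^ (-(1 + η)) := by
          rw [logWeight, ← mul_assoc]
          congr 1
          nth_rewrite 1 [← Real.rpow_one (1 + φ x)]
          rw [← Real.rpow_add hY]
          ring_nf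
      _ ≤ c i := by
          refine mul_le_mul ?_ ?_ ?_ (by positivity)
          · exact Real.rpow_le_rpow hY.le hi2.le (by positivity)
          · exact Real.rpow_le_rpow_of_nonpos (by positivity) hlog (by linarith)
          · exact Real.rpow_nonneg (le_trans (by positivity) hlog) _
  have hsummable : Summable fun i : ℕ ↦
      C' * 2 ^ (1 / s) * Real.log 2 ^ (-(1 + η)) * ((i + 1 : ℕ) : ℝ) ^ (-(1 + η)) := by
    refine Summable.mul_left _ ?_
    exact (summable_nat_add_iff 1).2 (Real.summable_nat_rpow.2 (by linarith))
  calc ∫⁻ x, ENNReal.ofReal (φ x * logWeight s η (φ x)) ∂μ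
      ≤ ∫⁻ x, ∑' i, (A i).indicator (fun _ ↦ ENNReal.ofReal (c i)) x ∂μ := lintegral_mono hpt
    _ = ∑' i, ENNReal.ofReal (c i) * μ (A i) := by
        rw [lintegral_tsum fun i ↦ (measurable_const.indicator (hA i)).aemeasurable]
        congr 1 with i
        rw [lintegral_indicator_const (hA i)]
    _ ≤ ∑' i : ℕ, ENNReal.ofReal
          (C' * 2 ^ (1 / s) * Real.log 2 ^ (-(1 + η)) * ((i + 1 : ℕ) : ℝ) ^ (-(1 + η))) := by
        refine ENNReal.tsum_le_tsum fun i ↦ ?_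
        refine (mul_le_mul_right (hμA i) _).trans_eq ?_
        rw [← ENNReal.ofReal_mul (hc0 i)]
        congr 1
        have h1 : ((2 : ℝ) ^ i) ^ (1 / s) * ((2 : ℝ) ^ i) ^ (-(1 / s)) = 1 := by
          rw [← Real.rpow_add (by positivity)]; simp
        simp only [c]
        rw [pow_succ, Real.mul_rpow (by positivity) (by norm_num),
          Real.mul_rpow hl2.le (by positivity)]
        push_cast
        linear_combination (C' * 2 ^ (1 / s) * Real.log 2 ^ (-(1 + η)) *
          ((i : ℝ) + 1) ^ (-(1 + η))) * h1
    _ < ⊤ := hsummable.tsum_ofReal_lt_top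

/-- A bootstrap: the logarithm is first bounded by a small power of `Y = 1 + S`, giving a crude
polynomial bound on `Y`. That makes `log Y` of order `log n`, and reinserting this gives the sharp
power. -/
theorem exists_le_of_mul_logWeight_le {s η : ℝ} (hs : 1 ≤ s) (hη : 0 < η) (K : ℝ) :
    ∃ K' : ℝ, ∀ n : ℕ, 3 ≤ n → ∀ S : ℝ, 0 ≤ S → S * logWeight s η S ≤ K * n →
      S ≤ K' * ((n : ℝ) ^ s * Real.log n ^ (s * (1 + η))) := by
  have hs0 : 0 < s := by linarith
  wlog hK : 0 ≤ K generalizing K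
  · obtain ⟨K', hK'⟩ := this 0 le_rfl
    refine ⟨K', fun n hn S hS h ↦ hK' n hn S hS (h.trans ?_)⟩
    exact mul_le_mul_of_nonneg_right (not_le.1 hK).le n.cast_nonneg
  -- With this exponent `L ^ (1 + η)` costs only `Y ^ (1 / (2 * s))`, half of the power on the left,
  -- and can be absorbed.
  set e : ℝ := 1 / (2 * s * (1 + η)) with he
  have he0 : 0 < e := by positivity
  set B : ℝ := (K + 1) * (1 + 1 / e) ^ (1 + η) with hB
  have hB0 : 0 < B := by positivity
  set G : ℝ := 1 + 2 * s * |Real.log B| + 2 * s with hG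
  have hG0 : 0 < G := by positivity
  refine ⟨((K + 1) * G ^ (1 + η)) ^ s, fun n hn S hS h ↦ ?_⟩
  have hn0 : (1 : ℝ) ≤ n := by exact_mod_cast (by omega : 1 ≤ n)
  have hlogn : 1 ≤ Real.log n := by
    rw [Real.le_log_iff_exp_le (by positivity)]
    have : (3 : ℝ) ≤ n := by exact_mod_cast hn
    linarith [Real.exp_one_lt_d9]
  set Y := 1 + S with hY
  have hY1 : 1 ≤ Y := by linarith
  have hY0 : 0 < Y := by linarith
  set L := 1 + Real.log Y with hL
  have hlY : 0 ≤ Real.log Y := Real.log_nonneg hY1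
  have hL1 : 1 ≤ L := by linarith
  have hLp : 1 ≤ L ^ (1 + η) := Real.one_le_rpow hL1 (by linarith)
  have h1 : S * Y ^ (1 / s - 1) ≤ K * n * L ^ (1 + η) := by
    rw [logWeight, ← hY, ← hL, Real.rpow_neg (by linarith), ← mul_assoc,
      ← div_eq_mul_inv, div_le_iff₀ (by linarith)] at h
    exact h
  have h2 : Y ^ (1 / s - 1) ≤ 1 := by
    refine Real.rpow_le_one_of_one_le_of_nonpos hY1 ?_
    rw [sub_nonpos, div_le_one hs0]; exact hs
  have h3 : Y ^ (1 / s) ≤ (K + 1) * n * L ^ (1 + η) := by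
    have h4 : Y ^ (1 / s) = S * Y ^ (1 / s - 1) + Y ^ (1 / s - 1) := by
      have : Y ^ (1 / s) = Y * Y ^ (1 / s - 1) := by
        nth_rewrite 2 [← Real.rpow_one Y]
        rw [← Real.rpow_add hY0]; ring_nf
      rw [this, hY]; ring
    have h5 : 1 ≤ (n : ℝ) * L ^ (1 + η) := one_le_mul_of_one_le_of_one_le hn0 hLp
    rw [h4]
    linarith
  have h6 : L ≤ (1 + 1 / e) * Y ^ e := by
    have h7 := Real.log_le_rpow_div hY0.le he0
    have h8 : 1 ≤ Y ^ e := Real.one_le_rpow hY1 he0.le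
    rw [add_mul, one_mul, one_div_mul_eq_div]
    linarith
  have h9 : L ^ (1 + η) ≤ (1 + 1 / e) ^ (1 + η) * Y ^ (1 / (2 * s)) := by
    refine (Real.rpow_le_rpow (by linarith) h6 (by linarith)).trans_eq ?_
    rw [Real.mul_rpow (by positivity) (by positivity), ← Real.rpow_mul hY0.le]
    congr 2
    rw [he]
    field_simp
  have h10 : Y ^ (1 / (2 * s)) ≤ B * n := by
    have h11 : Y ^ (1 / s) = Y ^ (1 / (2 * s)) * Y ^ (1 / (2 * s)) := by
      rw [← Real.rpow_add hY0]
      congr 1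
      field_simp
      norm_num
    have h12 : 0 < Y ^ (1 / (2 * s)) := by positivity
    rw [h11] at h3
    refine le_of_mul_le_mul_right (h3.trans ?_) h12
    calc (K + 1) * n * L ^ (1 + η)
        ≤ (K + 1) * n * ((1 + 1 / e) ^ (1 + η) * Y ^ (1 / (2 * s))) := by gcongr
      _ = B * n * Y ^ (1 / (2 * s)) := by rw [hB]; ring
  have h13 : L ≤ G * Real.log n := by
    have h14 := Real.log_le_log (by positivity) h10
    rw [Real.log_rpow hY0, Real.log_mul hB0.ne' (by positivity), one_div_mul_eq_div,
      div_le_iff₀ (by positivity)] at h14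
    have h15 := le_abs_self (Real.log B)
    have h16 : |Real.log B| ≤ |Real.log B| * Real.log n :=
      le_mul_of_one_le_right (abs_nonneg _) hlogn
    rw [hL, hG]
    nlinarith
  have h17 : Y ^ (1 / s) ≤ (K + 1) * G ^ (1 + η) * (n * Real.log n ^ (1 + η)) := by
    refine h3.trans ?_
    calc (K + 1) * n * L ^ (1 + η) ≤ (K + 1) * n * (G * Real.log n) ^ (1 + η) := by gcongr
      _ = _ := by rw [Real.mul_rpow hG0.le (by linarith)]; ring
  calc S ≤ Y := by linarith
    _ = (Y ^ (1 / s)) ^ s := by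
        rw [← Real.rpow_mul hY0.le, one_div_mul_cancel hs0.ne', Real.rpow_one]
    _ ≤ ((K + 1) * G ^ (1 + η) * (n * Real.log n ^ (1 + η))) ^ s :=
        Real.rpow_le_rpow (by positivity) h17 hs0.le
    _ = _ := by
        have : 0 ≤ Real.log n := by linarith
        rw [Real.mul_rpow (by positivity) (by positivity),
          Real.mul_rpow (x := (n : ℝ)) (by positivity) (by positivity), ← Real.rpow_mul this,
          mul_comm (1 + η) s]

/-- Birkhoff sums of a nonnegative function with tail `O(t ^ (-1 / s))`, `s ≥ 1`, are
`O(n ^ s * (log n) ^ (s + ε))` almost everywhere. -/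
theorem MeasureTheory.MeasurePreserving.ae_exists_birkhoffSum_le_of_tail {X : Type*}
    [MeasurableSpace X] {μ : Measure X} [IsProbabilityMeasure μ] {T : X → X}
    (hT : MeasurePreserving T μ μ) {s ε C : ℝ} (hs : 1 ≤ s) (hε : 0 < ε) (hC : 0 ≤ C) {φ : X → ℝ}
    (hφ : Measurable φ) (hφ0 : ∀ x, 0 ≤ φ x)
    (htail : ∀ t, 0 < t → μ {x | t ≤ φ x} ≤ ENNReal.ofReal (C * t ^ (-(1 / s)))) :
    ∀ᵐ x ∂μ, ∃ K : ℝ, ∀ n : ℕ, 3 ≤ n →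
      birkhoffSum T φ n x ≤ K * ((n : ℝ) ^ s * Real.log n ^ (s + ε)) := by
  have hs0 : 0 < s := by linarith
  have hη : 0 < ε / s := by positivity
  filter_upwards [hT.ae_exists_birkhoffSum_le (integrable_mul_logWeight hs hη hC hφ hφ0 htail)
    (hφ.mul ((measurable_logWeight s (ε / s)).comp hφ))] with x ⟨K, hK⟩
  obtain ⟨K', hK'⟩ := exists_le_of_mul_logWeight_le hs hη K
  refine ⟨K', fun n hn ↦ ?_⟩
  have h1 := hK' n hn (birkhoffSum T φ n x) (Finset.sum_nonneg fun j _ ↦ hφ0 _)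
    ((sum_mul_logWeight_sum_le hs hη _ _ fun j ↦ hφ0 _).trans (hK n))
  rwa [show s * (1 + ε / s) = s + ε by field_simp] at h1

end

/-! ### Lower bound: visits to small balls under decay of correlations -/

section

open ProbabilityTheory
open scoped NNReal ENNReal

theorem MeasureTheory.MeasurePreserving.integral_comp_of_measurable {X : Type*} [MeasurableSpace X]
    {μ : Measure X} {T : X → X} (hT : MeasurePreserving T μ μ) {g : X → ℝ} (hg : Measurable g) :
    ∫ x, g (T x) ∂μ = ∫ x, g x ∂μ := by
  rw [← integral_map hT.measurable.aemeasurable hg.aestronglyMeasurable, hT.map_eq]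

/-- Second moment bound for the probability that an observable with values in `[0, 1]`, whose
correlations are at most `δ` after time `l₀`, vanishes up to time `n`. -/
theorem MeasureTheory.MeasurePreserving.measure_forall_eq_zero_le {X : Type*} [MeasurableSpace X]
    {μ : Measure X} [IsProbabilityMeasure μ] {T : X → X} (hT : MeasurePreserving T μ μ)
    {f : X → ℝ} (hf : Measurable f) (hf0 : ∀ x, 0 ≤ f x) (hf1 : ∀ x, f x ≤ 1)
    (hpos : 0 < ∫ x, f x ∂μ) {δ : ℝ} {l₀ : ℕ}
    (hcorr : ∀ l, l₀ ≤ l → |∫ x, f x * f (T^[l] x) ∂μ - (∫ x, f x ∂μ) * ∫ x, f x ∂μ| ≤ δ)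
    {n : ℕ} (hn : 0 < n) :
    μ {x | ∀ j < n, f (T^[j] x) = 0} ≤
      ENNReal.ofReal (2 * l₀ / (n * ∫ x, f x ∂μ) + δ / (∫ x, f x ∂μ) ^ 2) := by
  set m := ∫ x, f x ∂μ with hm
  have hδ : 0 ≤ δ := (abs_nonneg _).trans (hcorr l₀ le_rfl)
  have hTj : ∀ j, MeasurePreserving T^[j] μ μ := fun j ↦ hT.iterate j
  let X' : ℕ → X → ℝ := fun j x ↦ f (T^[j] x)
  have hXm : ∀ j, Measurable (X' j) := fun j ↦ hf.comp (hTj j).measurable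
  have hXL : ∀ j, MemLp (X' j) 2 μ := fun j ↦
    MemLp.of_bound (hXm j).aestronglyMeasurable 1 (ae_of_all _ fun x ↦ by
      rw [Real.norm_eq_abs, abs_of_nonneg (hf0 _)]; exact hf1 _)
  have hXi : ∀ j, ∫ x, X' j x ∂μ = m := fun j ↦ (hTj j).integral_comp_of_measurable hf
  have hfi : Integrable f μ := (hXL 0).integrable (by norm_num)
  have hcov_le : ∀ a l, cov[X' a, X' (a + l); μ] =
      ∫ x, f x * f (T^[l] x) ∂μ - m * m := by
    intro a l
    rw [covariance_eq_sub (hXL a) (hXL _), hXi, hXi]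
    congr 1
    have h1 := (hTj a).integral_comp_of_measurable (g := fun x ↦ f x * f (T^[l] x))
      (hf.mul (hXm l))
    rw [← h1]
    refine integral_congr_ae (ae_of_all _ fun x ↦ ?_)
    simp only [Pi.mul_apply, X']
    rw [add_comm, Function.iterate_add_apply]
  have hcov1 : ∀ a l, cov[X' a, X' (a + l); μ] ≤ m := by
    intro a l
    rw [hcov_le]
    have : ∫ x, f x * f (T^[l] x) ∂μ ≤ m := by
      refine integral_mono_of_nonneg (ae_of_all _ fun x ↦ mul_nonneg (hf0 _) (hf0 _)) hfi
        (ae_of_all _ fun x ↦ mul_le_of_le_one_right (hf0 _) (hf1 _))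
    nlinarith
  have hcov2 : ∀ a l, l₀ ≤ l → cov[X' a, X' (a + l); μ] ≤ δ := fun a l hl ↦ by
    rw [hcov_le]; exact (le_abs_self _).trans (hcorr l hl)
  -- Times less than `l₀` apart are bounded trivially by `m`, as `f ≤ 1`; all other pairs are
  -- decorrelated up to `δ`. The truncated subtraction is harmless: the window still has at most `2
  -- * l₀` elements.
  have hcov : ∀ a b, cov[X' a, X' b; μ] ≤ (if b ∈ Finset.Ico (a + 1 - l₀) (a + l₀) then m else 0)
      + δ := by
    intro a b
    rcases le_total a b with hab | hab
    · obtain ⟨l, rfl⟩ := Nat.exists_eq_add_of_le hab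
      split_ifs with h
      · exact (hcov1 a l).trans (by linarith)
      · rw [zero_add]
        refine hcov2 a l ?_
        simp only [Finset.mem_Ico] at h
        omega
    · obtain ⟨l, rfl⟩ := Nat.exists_eq_add_of_le hab
      rw [covariance_comm]
      split_ifs with h
      · exact (hcov1 b l).trans (by linarith)
      · rw [zero_add]
        refine hcov2 b l ?_
        simp only [Finset.mem_Ico] at h
        omega
  set N : X → ℝ := fun x ↦ ∑ j ∈ Finset.range n, X' j x with hN
  have hNL : MemLp N 2 μ := memLp_finsetSum _ fun j _ ↦ hXL j
  have hNmean : ∫ x, N x ∂μ = n * m := by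
    rw [hN, integral_finsetSum _ fun j _ ↦ (hXL j).integrable (by norm_num)]
    simp [hXi]
  have hn0 : (0 : ℝ) < n := by exact_mod_cast hn
  have hvar : Var[N; μ] ≤ n * (2 * l₀ * m + n * δ) := by
    rw [hN, variance_fun_sum' fun j _ ↦ hXL j]
    have h1 : ∀ a, ∑ b ∈ Finset.range n, cov[X' a, X' b; μ] ≤ 2 * l₀ * m + n * δ := by
      intro a
      refine (Finset.sum_le_sum fun b _ ↦ hcov a b).trans ?_
      rw [Finset.sum_add_distrib, Finset.sum_const, Finset.card_range, nsmul_eq_mul,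
        Finset.sum_ite_mem, Finset.sum_const, nsmul_eq_mul]
      gcongr
      have : (Finset.range n ∩ Finset.Ico (a + 1 - l₀) (a + l₀)).card ≤ 2 * l₀ := by
        refine (Finset.card_le_card Finset.inter_subset_right).trans ?_
        rw [Nat.card_Ico]
        omega
      exact_mod_cast this
    refine (Finset.sum_le_sum fun a _ ↦ h1 a).trans_eq ?_
    rw [Finset.sum_const, Finset.card_range, nsmul_eq_mul]
  -- If every term vanishes, the sum deviates from its mean by the full mean `n * m`, so Chebyshev
  -- applies.
  calc μ {x | ∀ j < n, f (T^[j] x) = 0} ≤ μ {x | n * m ≤ |N x - ∫ y, N y ∂μ|} := by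
        refine measure_mono fun x hx ↦ ?_
        have : N x = 0 := Finset.sum_eq_zero fun j hj ↦ hx j (Finset.mem_range.1 hj)
        simp only [mem_ofPred_eq]
        rw [this, hNmean, zero_sub, abs_neg]
        exact le_abs_self _
    _ ≤ ENNReal.ofReal (Var[N; μ] / (n * m) ^ 2) :=
        meas_ge_le_variance_div_sq hNL (by positivity)
    _ ≤ _ := by
        refine ENNReal.ofReal_le_ofReal ?_
        calc Var[N; μ] / (n * m) ^ 2 ≤ n * (2 * l₀ * m + n * δ) / (n * m) ^ 2 := by gcongr
          _ = _ := by field_simp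

/-- The tent function equal to `1` on the ball of radius `r / 2` and to `0` outside the ball of
radius `r`. -/
noncomputable def tent {X : Type*} [MetricSpace X] (p : X) (r : ℝ) (x : X) : ℝ :=
  max 0 (min 1 (2 - 2 / r * dist x p))

section tent

variable {X : Type*} [MetricSpace X] (p : X) {r : ℝ}

theorem tent_nonneg (r : ℝ) (x : X) : 0 ≤ tent p r x := le_max_left _ _

theorem tent_le_one (r : ℝ) (x : X) : tent p r x ≤ 1 := max_le zero_le_one (min_le_left _ _)

theorem tent_eq_one (hr : 0 < r) {x : X} (hx : dist x p ≤ r / 2) : tent p r x = 1 := by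
  have : 2 / r * dist x p ≤ 1 := by
    rw [div_mul_eq_mul_div, div_le_one hr]; linarith
  rw [tent, min_eq_left (by linarith), max_eq_right zero_le_one]

theorem dist_lt_of_tent_ne_zero (hr : 0 < r) {x : X} (hx : tent p r x ≠ 0) : dist x p < r := by
  by_contra! h
  refine hx (max_eq_left ((min_le_right _ _).trans ?_))
  rw [sub_nonpos, div_mul_eq_mul_div, le_div_iff₀ hr]
  linarith

theorem abs_tent_sub_le (hr : 0 < r) (x y : X) :
    |tent p r x - tent p r y| ≤ 2 / r * dist x y := by
  have h1 : |tent p r x - tent p r y| ≤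
      |min 1 (2 - 2 / r * dist x p) - min 1 (2 - 2 / r * dist y p)| := by
    rw [tent, tent, max_comm 0, max_comm 0]
    exact abs_max_sub_max_le_abs _ _ _
  refine h1.trans ?_
  refine (abs_min_sub_min_le_max _ _ _ _).trans ?_
  rw [sub_self, abs_zero, max_eq_right (abs_nonneg _),
    show 2 - 2 / r * dist x p - (2 - 2 / r * dist y p) = 2 / r * (dist y p - dist x p) by ring,
    abs_mul, abs_of_pos (by positivity)]
  gcongr
  rw [dist_comm x y]
  exact abs_dist_sub_le y x p

theorem isBddLipschitz_tent (hr : 0 < r) : IsBddLipschitz (tent p r) :=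
  ⟨⟨1, fun x ↦ by rw [abs_of_nonneg (tent_nonneg p r x)]; exact tent_le_one p r x⟩,
    2 / r, by positivity, abs_tent_sub_le p hr⟩

theorem lipNorm_nonneg (f : X → ℝ) : 0 ≤ lipNorm f :=
  add_nonneg (Real.iSup_nonneg fun _ ↦ abs_nonneg _) (Real.sInf_nonneg fun _ h ↦ h.1)

theorem lipNorm_tent_le (hr : 0 < r) (hr1 : r ≤ 1) : lipNorm (tent p r) ≤ 3 / r := by
  have h1 : (⨆ x, |tent p r x|) ≤ 1 := Real.iSup_le (fun x ↦ by
    rw [abs_of_nonneg (tent_nonneg p r x)]; exact tent_le_one p r x) zero_le_one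
  have h2 : sInf {K : ℝ | 0 ≤ K ∧ ∀ x y, |tent p r x - tent p r y| ≤ K * dist x y} ≤ 2 / r :=
    csInf_le ⟨0, fun K hK ↦ hK.1⟩ ⟨by positivity, abs_tent_sub_le p hr⟩
  have h3 : 1 ≤ 1 / r := by rw [le_div_iff₀ hr]; linarith
  calc lipNorm (tent p r) ≤ 1 / r + 2 / r := add_le_add (h1.trans h3) h2
    _ = 3 / r := by ring

theorem measurable_tent [MeasurableSpace X] [OpensMeasurableSpace X] (r : ℝ) :
    Measurable (tent p r) := by
  unfold tent
  fun_prop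

end tent

/-- Under exponential decay of correlations, the probability that an orbit avoids the ball of
radius `r` around `p` up to time `n`. -/
theorem ExpDecayOfCorrelations.exists_measure_forall_le_dist {X : Type*} [MetricSpace X]
    [MeasurableSpace X] [BorelSpace X] {T : X → X} {μ : Measure X} [IsProbabilityMeasure μ]
    (hA : ExpDecayOfCorrelations T μ) (hT : MeasurePreserving T μ μ) :
    ∃ C θ : ℝ, 0 < C ∧ 0 < θ ∧ θ < 1 ∧ ∀ (p : X) (r M : ℝ) (l n : ℕ), 0 < r → r ≤ 1 → 0 < n →
      0 < M → ENNReal.ofReal M ≤ μ (Metric.ball p (r / 2)) →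
      μ {x | ∀ j < n, r ≤ dist (T^[j] x) p} ≤
        ENNReal.ofReal (2 * l / (n * M) + C * θ ^ l / (r ^ 2 * M ^ 2)) := by
  obtain ⟨C, θ, hC, hθ, hθ1, hcorr⟩ := hA
  -- The factor `9` comes from the two Lipschitz norms, each at most `3 / r`.
  refine ⟨9 * C, θ, by positivity, hθ, hθ1, fun p r M l n hr hr1 hn hM hball ↦ ?_⟩
  set f := tent p r
  have hfi : Integrable f μ :=
    Integrable.of_bound (measurable_tent p r).aestronglyMeasurable 1 (ae_of_all _ fun x ↦ by
      rw [Real.norm_eq_abs, abs_of_nonneg (tent_nonneg p r x)]; exact tent_le_one p r x)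
  have hMf : M ≤ ∫ x, f x ∂μ := by
    have h1 : M ≤ μ.real (Metric.ball p (r / 2)) :=
      (ENNReal.ofReal_le_iff_le_toReal (measure_ne_top _ _)).1 hball
    refine h1.trans ?_
    rw [← integral_indicator_one Metric.isOpen_ball.measurableSet]
    refine integral_mono ((integrable_const (1 : ℝ)).indicator Metric.isOpen_ball.measurableSet)
      hfi fun x ↦ ?_
    by_cases hx : x ∈ Metric.ball p (r / 2)
    · rw [indicator_of_mem hx]
      exact (tent_eq_one p hr (Metric.mem_ball.1 hx).le).ge
    · rw [indicator_of_notMem hx]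
      exact tent_nonneg p r x
  have hfpos : 0 < ∫ x, f x ∂μ := hM.trans_le hMf
  have hn0 : (0 : ℝ) < n := by exact_mod_cast hn
  have hdecay : ∀ l', l ≤ l' →
      |∫ x, f x * f (T^[l'] x) ∂μ - (∫ x, f x ∂μ) * ∫ x, f x ∂μ| ≤ C * θ ^ l * (3 / r) * (3 / r) := by
    intro l' hl
    refine (hcorr f f (isBddLipschitz_tent p hr) (isBddLipschitz_tent p hr) l').trans ?_
    have h1 := lipNorm_tent_le p hr hr1
    have h2 := lipNorm_nonneg f
    have h3 : θ ^ l' ≤ θ ^ l := pow_le_pow_of_le_one hθ.le hθ1.le hl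
    gcongr
  calc μ {x | ∀ j < n, r ≤ dist (T^[j] x) p} ≤ μ {x | ∀ j < n, f (T^[j] x) = 0} := by
        refine measure_mono fun x hx j hj ↦ ?_
        by_contra h
        exact absurd (dist_lt_of_tent_ne_zero p hr h) (not_lt.2 (hx j hj))
    _ ≤ _ := hT.measure_forall_eq_zero_le (measurable_tent p r) (tent_nonneg p r)
        (tent_le_one p r) hfpos hdecay hn
    _ ≤ _ := by
        refine ENNReal.ofReal_le_ofReal ?_
        calc _ ≤ 2 * l / (n * M) + C * θ ^ l * (3 / r) * (3 / r) / M ^ 2 := by gcongr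
          _ = _ := by field_simp; ring

/-- If balls of radius `r` around `p` have mass at least `c * r ^ β`, then almost every orbit
comes within distance `(i ^ 3 / 2 ^ i) ^ (1 / β)` of `p` before time `2 ^ i`, for all large `i`. -/
theorem ExpDecayOfCorrelations.ae_eventually_exists_dist_lt {X : Type*} [MetricSpace X]
    [MeasurableSpace X] [BorelSpace X] {T : X → X} {μ : Measure X} [IsProbabilityMeasure μ]
    (hA : ExpDecayOfCorrelations T μ) (hT : MeasurePreserving T μ μ) {p : X} {c β r₀ : ℝ}
    (hc : 0 < c) (hβ : 0 < β) (hr₀ : 0 < r₀)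
    (hball : ∀ r, 0 < r → r ≤ r₀ → ENNReal.ofReal (c * r ^ β) ≤ μ (Metric.ball p r)) :
    ∀ᵐ x ∂μ, ∀ᶠ i : ℕ in atTop, ∃ j < 2 ^ i,
      dist (T^[j] x) p < ((i : ℝ) ^ 3 / 2 ^ i) ^ (1 / β) := by
  obtain ⟨C, θ, hC, hθ, hθ1, hmeas⟩ := hA.exists_measure_forall_le_dist hT
  set r : ℕ → ℝ := fun i ↦ ((i : ℝ) ^ 3 / 2 ^ i) ^ (1 / β) with hr
  have hr0 : Tendsto r atTop (𝓝 0) := by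
    have h1 : Tendsto (fun i : ℕ ↦ (i : ℝ) ^ 3 / 2 ^ i) atTop (𝓝 0) :=
      tendsto_pow_const_div_const_pow_of_one_lt 3 (by norm_num)
    have h2 := h1.rpow_const (p := 1 / β) (.inr (by positivity))
    rwa [Real.zero_rpow (by positivity)] at h2
  obtain ⟨N, hN⟩ : ∃ N : ℕ, ∀ i, N ≤ i → r i ≤ min 1 r₀ ∧ 1 ≤ i := by
    have := (hr0.eventually_le_const (lt_min one_pos hr₀)).and (eventually_ge_atTop 1)
    exact eventually_atTop.1 this
  -- `b ^ i` dominates `1 / (r i ^ 2 * M ^ 2)` up to a constant: `2 ^ (2 / β)` comes from `r i ^ 2`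
  -- and `4` from `M ^ 2`. A correlation gap `A * i`, logarithmic in the time `2 ^ i`, then makes `θ
  -- ^ (A * i)` win.
  set b : ℝ := (2 : ℝ) ^ (2 / β) * 4 with hb
  have hb0 : 0 < b := by positivity
  obtain ⟨A, hAθ⟩ : ∃ A : ℕ, θ ^ A < 1 / (2 * b) :=
    exists_pow_lt_of_lt_one (by positivity) hθ1
  set c' : ℝ := c * (1 / 2) ^ β with hc'
  have hc'0 : 0 < c' := by positivity
  -- With gap `A * i` and expected number of visits of order `i ^ 3`, the first term is of order `i
  -- ^ (-2)`; this is why the radius carries `i ^ 3`.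
  set F : ℕ → ℝ := fun i ↦ 2 * A / c' * (1 / (i : ℝ) ^ 2) + C / c' ^ 2 * (1 / 2) ^ i with hF
  have hFsum : Summable F :=
    ((Real.summable_one_div_nat_pow.2 (by norm_num)).mul_left _).add
      ((summable_geometric_of_lt_one (by norm_num) (by norm_num)).mul_left _)
  set S : ℕ → Set X := fun i ↦ {x | ∀ j < 2 ^ i, r i ≤ dist (T^[j] x) p} with hS
  have hbound : ∀ i, N ≤ i → μ (S i) ≤ ENNReal.ofReal (F i) := by
    intro i hi
    obtain ⟨hri, hi1⟩ := hN i hi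
    have hi0 : (1 : ℝ) ≤ i := by exact_mod_cast hi1
    have hq : 0 < (i : ℝ) ^ 3 / 2 ^ i := by positivity
    have hrpos : 0 < r i := by positivity
    set M : ℝ := c' * ((i : ℝ) ^ 3 / 2 ^ i) with hM
    have hMball : ENNReal.ofReal M ≤ μ (Metric.ball p (r i / 2)) := by
      refine le_trans (ENNReal.ofReal_le_ofReal (le_of_eq ?_)) (hball _ (by positivity)
        (by linarith [min_le_right 1 r₀]))
      rw [hM, hc', div_eq_mul_one_div (r i) 2, Real.mul_rpow hrpos.le (by norm_num), hr]
      simp only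
      rw [← Real.rpow_mul hq.le, one_div_mul_cancel hβ.ne', Real.rpow_one]
      ring
    refine (hmeas p (r i) M (A * i) (2 ^ i) hrpos (hri.trans (min_le_left _ _)) (by positivity)
      (by positivity) hMball).trans (ENNReal.ofReal_le_ofReal (add_le_add (le_of_eq ?_) ?_))
    · rw [hM]
      push_cast
      field_simp
    · have h2i : (0 : ℝ) < 2 ^ i := by positivity
      have hi3 : (1 : ℝ) ≤ (i : ℝ) ^ 3 := one_le_pow₀ hi0
      have hM' : c' / 2 ^ i ≤ M := by
        rw [hM, mul_div_assoc', div_le_div_iff_of_pos_right h2i]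
        exact le_mul_of_one_le_right hc'0.le hi3
      have hr' : ((1 : ℝ) / 2 ^ (2 / β)) ^ i ≤ r i ^ 2 := by
        have h1 : ((1 : ℝ) / 2 ^ i) ^ (1 / β) ≤ r i := by
          refine Real.rpow_le_rpow (by positivity) ?_ (by positivity)
          gcongr
        refine le_trans (le_of_eq ?_) (pow_le_pow_left₀ (by positivity) h1 2)
        rw [Real.div_rpow zero_le_one (by positivity), Real.one_rpow, div_pow, div_pow, one_pow,
          one_pow]
        congr 1
        rw [← Real.rpow_natCast, ← Real.rpow_natCast, ← Real.rpow_natCast,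
          ← Real.rpow_mul (by norm_num), ← Real.rpow_mul (by norm_num),
          ← Real.rpow_mul (by norm_num)]
        congr 1
        push_cast
        ring
      calc C * θ ^ (A * i) / (r i ^ 2 * M ^ 2)
          ≤ C * θ ^ (A * i) / (((1 : ℝ) / 2 ^ (2 / β)) ^ i * (c' / 2 ^ i) ^ 2) := by gcongr
        _ = C / c' ^ 2 * (θ ^ A * b) ^ i := by
            have h4 : (4 : ℝ) ^ i = 2 ^ i * 2 ^ i := by rw [← mul_pow]; norm_num
            have h5 : (θ ^ A * b) ^ i = θ ^ (A * i) * (((2 : ℝ) ^ (2 / β)) ^ i * (2 ^ i * 2 ^ i)) := by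
              rw [mul_pow, ← pow_mul, hb, mul_pow, h4]
            rw [h5, div_pow 1, one_pow]
            field_simp
        _ ≤ C / c' ^ 2 * (1 / 2) ^ i := by
            gcongr
            rw [lt_div_iff₀ (by positivity)] at hAθ
            linarith
  have hfin : ∑' i, μ (S (i + N)) ≠ ⊤ := by
    refine ((ENNReal.tsum_le_tsum fun i ↦ hbound (i + N) (Nat.le_add_left _ _)).trans_lt ?_).ne
    exact ((summable_nat_add_iff N).2 hFsum).tsum_ofReal_lt_top
  filter_upwards [ae_eventually_notMem hfin] with x hx
  rw [← map_add_atTop_eq_nat N, eventually_map]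
  filter_upwards [hx] with i hi
  simpa only [hS, mem_ofPred_eq, not_forall, not_le, exists_prop] using hi

end

/-! ### Tail of the observable and contribution of a single close visit -/

section

open scoped NNReal ENNReal

theorem distBirkhoffSum_nonneg {X : Type*} [MetricSpace X] (T : X → X) (p : X) (k : ℝ)
    (n : ℕ) (x : X) : 0 ≤ distBirkhoffSum T p k n x :=
  Finset.sum_nonneg fun _ _ ↦ Real.rpow_nonneg dist_nonneg _

/-- The tail of `dist · p ^ (-k)` when the mass of balls around `p` is at most `C * r ^ β`. -/
theorem exists_measure_le_dist_rpow_le {X : Type*} [MetricSpace X] [MeasurableSpace X]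
    {μ : Measure X} [IsProbabilityMeasure μ] {p : X} {C r₀ β k : ℝ} (hC : 0 < C) (hr₀ : 0 < r₀)
    (hβ : 0 < β) (hk : 0 < k)
    (hball : ∀ r, 0 < r → r ≤ r₀ → μ (Metric.ball p r) ≤ ENNReal.ofReal (C * r ^ β)) :
    ∃ C', 0 ≤ C' ∧ ∀ t, 0 < t →
      μ {x | t ≤ dist x p ^ (-k)} ≤ ENNReal.ofReal (C' * t ^ (-(1 / (k / β)))) := by
  -- The first summand serves the doubled ball of radius `2 * ρ ≤ r₀`; the second makes the bound at
  -- least `1` when `2 * ρ > r₀`.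
  refine ⟨C * 2 ^ β + (2 / r₀) ^ β, by positivity, fun t ht ↦ ?_⟩
  set ρ := t ^ (-(1 / k)) with hρ
  have hρ0 : 0 < ρ := by positivity
  have hρβ : ρ ^ β = t ^ (-(1 / (k / β))) := by
    rw [hρ, ← Real.rpow_mul ht.le]
    congr 1
    field_simp
  rw [← hρβ]
  have hsub : {x | t ≤ dist x p ^ (-k)} ⊆ Metric.ball p (2 * ρ) := by
    intro x hx
    have hx : t ≤ dist x p ^ (-k) := hx
    -- At `p` itself the real power `0 ^ (-k)` is `0`, so `p` does not lie in the superlevel set.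
    rcases eq_or_lt_of_le (dist_nonneg (x := x) (y := p)) with h0 | h0
    · rw [← h0, Real.zero_rpow (by linarith)] at hx
      linarith
    · have h1 : (dist x p ^ (-k)) ^ (-(1 / k)) ≤ ρ :=
        Real.rpow_le_rpow_of_nonpos ht hx (by
          have : 0 < 1 / k := by positivity
          linarith)
      rw [← Real.rpow_mul h0.le, show -k * -(1 / k) = 1 by field_simp, Real.rpow_one] at h1
      rw [Metric.mem_ball]
      linarith
  have h1 : 0 ≤ C * 2 ^ β * ρ ^ β := by positivity
  have h2 : 0 ≤ (2 / r₀) ^ β * ρ ^ β := by positivity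
  by_cases h : 2 * ρ ≤ r₀
  · refine (measure_mono hsub).trans ((hball _ (by positivity) h).trans
      (ENNReal.ofReal_le_ofReal ?_))
    rw [Real.mul_rpow (by norm_num) hρ0.le, add_mul]
    linarith
  · refine prob_le_one.trans ?_
    rw [← ENNReal.ofReal_one]
    refine ENNReal.ofReal_le_ofReal ?_
    have h3 : 1 ≤ (2 / r₀ * ρ) ^ β := by
      refine Real.one_le_rpow ?_ hβ.le
      rw [div_mul_eq_mul_div, le_div_iff₀ hr₀]
      linarith
    rw [Real.mul_rpow (by positivity) hρ0.le] at h3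
    rw [add_mul]
    linarith

/-- Close approaches of an orbit to `p` bound the Birkhoff sums of `dist · p ^ (-k)` below. -/
theorem eventually_le_distBirkhoffSum {X : Type*} [MetricSpace X] {T : X → X} {p x : X} {β k : ℝ}
    (hβ : 0 < β) (hk : 0 < k) (hne : ∀ j : ℕ, T^[j] x ≠ p)
    (hx : ∀ᶠ i : ℕ in atTop, ∃ j < 2 ^ i, dist (T^[j] x) p < ((i : ℝ) ^ 3 / 2 ^ i) ^ (1 / β)) :
    ∀ᶠ n : ℕ in atTop, ((n : ℝ) / (16 * Real.log n ^ 3)) ^ (k / β) ≤ distBirkhoffSum T p k n x := by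
  obtain ⟨i₀, hi₀⟩ := eventually_atTop.1 (hx.and (eventually_ge_atTop 1))
  filter_upwards [eventually_ge_atTop (2 ^ i₀)] with n hn
  have hn0 : n ≠ 0 := (lt_of_lt_of_le (by positivity) hn).ne'
  -- The visit before time `2 ^ i ≤ n` already belongs to the sum. The constant `16 = 2 * 8` comes
  -- from `n ≤ 2 * 2 ^ i` and `i ≤ 2 * log n`.
  set i := Nat.log 2 n with hi
  have hii : i₀ ≤ i := (Nat.le_log_iff_pow_le (by norm_num) hn0).2 hn
  obtain ⟨⟨j, hj, hjd⟩, hi1⟩ := hi₀ i hii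
  have h2i : 2 ^ i ≤ n := Nat.pow_log_le_self 2 hn0
  have h2i' : n < 2 ^ (i + 1) := Nat.lt_pow_succ_log_self (by norm_num) n
  have h3 : (2 : ℝ) ^ i ≤ n := by exact_mod_cast h2i
  have h4 : (n : ℝ) ≤ 2 * 2 ^ i := by
    have : (n : ℝ) < 2 ^ (i + 1) := by exact_mod_cast h2i'
    rw [pow_succ] at this
    linarith
  have hi0 : (0 : ℝ) < i := by exact_mod_cast hi1
  have hilog : (i : ℝ) ≤ 2 * Real.log n := by
    have h5 := Real.log_le_log (by positivity) h3
    rw [Real.log_pow] at h5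
    nlinarith [Real.log_two_gt_d9]
  have hi3 : (i : ℝ) ^ 3 ≤ 8 * Real.log n ^ 3 :=
    (pow_le_pow_left₀ hi0.le hilog 3).trans_eq (by ring)
  have hd : 0 < dist (T^[j] x) p := dist_pos.2 (hne j)
  have hq : 0 < (i : ℝ) ^ 3 / 2 ^ i := by positivity
  calc ((n : ℝ) / (16 * Real.log n ^ 3)) ^ (k / β) ≤ (2 ^ i / (i : ℝ) ^ 3) ^ (k / β) := by
        have hL : 0 < Real.log n := by linarith
        refine Real.rpow_le_rpow (by positivity) ?_ (by positivity)
        rw [div_le_div_iff₀ (by positivity) (by positivity)]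
        calc (n : ℝ) * (i : ℝ) ^ 3 ≤ (2 * 2 ^ i) * (8 * Real.log n ^ 3) := by gcongr
          _ = _ := by ring
    _ = (((i : ℝ) ^ 3 / 2 ^ i) ^ (1 / β)) ^ (-k) := by
        rw [← Real.rpow_mul hq.le, ← inv_div, Real.inv_rpow hq.le, ← Real.rpow_neg hq.le]
        congr 1
        ring
    _ ≤ dist (T^[j] x) p ^ (-k) := Real.rpow_le_rpow_of_nonpos hd hjd.le (by linarith)
    _ ≤ _ := Finset.single_le_sum (f := fun j ↦ dist (T^[j] x) p ^ (-k))
        (fun _ _ ↦ Real.rpow_nonneg dist_nonneg _) (Finset.mem_range.2 (hj.trans_le h2i))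

/-! ### From explicit bounds to limsup, liminf and the logarithmic limit -/

section asymptotics

variable {u : ℕ → ℝ} {s : ℝ}

theorem tendsto_log_natCast_atTop : Tendsto (fun n : ℕ ↦ Real.log n) atTop atTop :=
  Real.tendsto_log_atTop.comp tendsto_natCast_atTop_atTop

theorem limsup_eq_zero_of_le_rpow_log {ε K : ℝ} (hε : 0 < ε) (hu0 : ∀ n, 0 ≤ u n)
    (hu : ∀ n : ℕ, 3 ≤ n → u n ≤ K * ((n : ℝ) ^ s * Real.log n ^ (s + ε / 2))) :
    limsup (fun n : ℕ ↦ ((u n / ((n : ℝ) ^ s * Real.log n ^ (s + ε)) : ℝ) : EReal)) atTop = 0 := by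
  have h1 : Tendsto (fun n : ℕ ↦ K * Real.log n ^ (-(ε / 2))) atTop (𝓝 0) := by
    simpa using ((tendsto_rpow_neg_atTop (half_pos hε)).comp
      tendsto_log_natCast_atTop).const_mul K
  have h2 : Tendsto (fun n : ℕ ↦ u n / ((n : ℝ) ^ s * Real.log n ^ (s + ε))) atTop (𝓝 0) := by
    refine tendsto_of_tendsto_of_tendsto_of_le_of_le' tendsto_const_nhds h1 ?_ ?_
    · filter_upwards [eventually_ge_atTop 3] with n hn
      have := Real.log_natCast_nonneg n
      have := hu0 n
      positivity
    · filter_upwards [eventually_ge_atTop 3] with n hn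
      have hn0 : (0 : ℝ) < n := by exact_mod_cast (by omega : 0 < n)
      have hL : 0 < Real.log n := Real.log_pos (by exact_mod_cast (by omega : 1 < n))
      rw [div_le_iff₀ (by positivity)]
      refine (hu n hn).trans_eq ?_
      have : Real.log n ^ (s + ε / 2) = Real.log n ^ (-(ε / 2)) * Real.log n ^ (s + ε) := by
        rw [← Real.rpow_add hL]; ring_nf
      rw [this]
      ring
  have h3 := (continuous_coe_real_ereal.tendsto 0).comp h2
  exact h3.limsup_eq

/-- With `y = (log n) ^ (1 / 2 + ε)` one has `(log n) ^ 3 ≤ y ^ 6`, and `exp y` eventually exceeds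
`32 * y ^ 6`. The spare factor `2` keeps the ratio at least `2`, so the liminf is strictly above
`1`. -/
theorem one_lt_liminf_of_rpow_div_log_le {ε : ℝ} (hs : 1 ≤ s) (hε : 0 < ε)
    (hu : ∀ᶠ n : ℕ in atTop, ((n : ℝ) / (16 * Real.log n ^ 3)) ^ s ≤ u n) :
    1 < liminf (fun n : ℕ ↦ ((u n /
      ((n : ℝ) ^ s * Real.exp (-(Real.log n ^ (1 / 2 + ε))) ^ s) : ℝ) : EReal)) atTop := by
  have hlarge : ∀ᶠ n : ℕ in atTop,
      32 ≤ Real.exp (Real.log n ^ (1 / 2 + ε)) / (Real.log n ^ (1 / 2 + ε)) ^ 6 :=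
    ((Real.tendsto_exp_div_pow_atTop 6).comp ((tendsto_rpow_atTop (by positivity)).comp
      tendsto_log_natCast_atTop)).eventually_ge_atTop 32
  have h2 : ∀ᶠ n : ℕ in atTop, (2 : EReal) ≤ ((u n /
      ((n : ℝ) ^ s * Real.exp (-(Real.log n ^ (1 / 2 + ε))) ^ s) : ℝ) : EReal) := by
    filter_upwards [hu, hlarge, eventually_ge_atTop 3,
      tendsto_log_natCast_atTop.eventually_ge_atTop 1] with n hn hexp hn3 hL
    have hn0 : (0 : ℝ) < n := by exact_mod_cast (by omega : 0 < n)
    set L := Real.log n with hLdef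
    set y := L ^ (1 / 2 + ε) with hy
    have hL0 : 0 < L := by linarith
    have hy0 : 0 < y := by positivity
    have hLy : L ^ 3 ≤ y ^ 6 := by
      have h3 : L ^ (1 / 2 : ℝ) ≤ y := Real.rpow_le_rpow_of_exponent_le hL (by linarith)
      have h4 : (L ^ (1 / 2 : ℝ)) ^ 6 = L ^ 3 := by
        rw [← Real.rpow_natCast, ← Real.rpow_mul hL0.le, ← Real.rpow_natCast]
        norm_num
      rw [← h4]
      exact pow_le_pow_left₀ (by positivity) h3 6
    rw [le_div_iff₀ (by positivity)] at hexp
    have h5 : (2 : ℝ) ≤ u n / ((n : ℝ) ^ s * Real.exp (-y) ^ s) := by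
      rw [le_div_iff₀ (by positivity), ← Real.mul_rpow hn0.le (Real.exp_pos _).le]
      refine le_trans ?_ hn
      calc 2 * ((n : ℝ) * Real.exp (-y)) ^ s ≤ 2 ^ s * ((n : ℝ) * Real.exp (-y)) ^ s := by
            gcongr
            simpa using Real.rpow_le_rpow_of_exponent_le (by norm_num : (1 : ℝ) ≤ 2) hs
        _ = (2 * (n * Real.exp (-y))) ^ s := by
            rw [Real.mul_rpow (x := (2 : ℝ)) (by norm_num) (by positivity)]
        _ ≤ _ := by
            refine Real.rpow_le_rpow (by positivity) ?_ (by linarith)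
            rw [Real.exp_neg, le_div_iff₀ (by positivity), ← div_eq_mul_inv, mul_div_assoc',
              div_mul_eq_mul_div, div_le_iff₀ (Real.exp_pos _)]
            have : (n : ℝ) * (32 * L ^ 3) ≤ n * Real.exp y :=
              mul_le_mul_of_nonneg_left (by linarith) hn0.le
            linarith
    exact EReal.coe_le_coe_iff.2 h5
  refine lt_of_lt_of_le (b := (2 : EReal)) ?_ (le_liminf_of_le (by isBoundedDefault) h2)
  exact_mod_cast (by norm_num : (1 : ℝ) < 2)

theorem tendsto_log_div_log_of_rpow_bounds {K : ℝ}
    (hlow : ∀ᶠ n : ℕ in atTop, ((n : ℝ) / (16 * Real.log n ^ 3)) ^ s ≤ u n)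
    (hup : ∀ n : ℕ, 3 ≤ n → u n ≤ K * ((n : ℝ) ^ s * Real.log n ^ (s + 1))) :
    Tendsto (fun n : ℕ ↦ Real.log (u n) / Real.log n) atTop (𝓝 s) := by
  have hinv : Tendsto (fun n : ℕ ↦ 1 / Real.log n) atTop (𝓝 0) :=
    tendsto_const_nhds.div_atTop tendsto_log_natCast_atTop
  have hloglog : Tendsto (fun n : ℕ ↦ Real.log (Real.log n) / Real.log n) atTop (𝓝 0) :=
    Real.isLittleO_log_id_atTop.tendsto_div_nhds_zero.comp tendsto_log_natCast_atTop
  have hl : Tendsto (fun n : ℕ ↦ s * (1 - Real.log 16 * (1 / Real.log n) -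
      3 * (Real.log (Real.log n) / Real.log n))) atTop (𝓝 s) := by
    have := (((hinv.const_mul (Real.log 16)).const_sub 1).sub (hloglog.const_mul 3)).const_mul s
    simpa using this
  have hr : Tendsto (fun n : ℕ ↦ Real.log K * (1 / Real.log n) + s +
      (s + 1) * (Real.log (Real.log n) / Real.log n)) atTop (𝓝 s) := by
    have := ((hinv.const_mul (Real.log K)).add_const s).add (hloglog.const_mul (s + 1))
    simpa using this
  refine tendsto_of_tendsto_of_tendsto_of_le_of_le' hl hr ?_ ?_
  · filter_upwards [hlow, eventually_ge_atTop 3] with n hn hn3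
    have hn0 : (0 : ℝ) < n := by exact_mod_cast (by omega : 0 < n)
    have hL : 0 < Real.log n := Real.log_pos (by exact_mod_cast (by omega : 1 < n))
    rw [le_div_iff₀ hL]
    refine le_trans (le_of_eq ?_) (Real.log_le_log (by positivity) hn)
    rw [Real.log_rpow (by positivity), Real.log_div (by positivity) (by positivity),
      Real.log_mul (by norm_num) (by positivity), Real.log_pow]
    field_simp
    push_cast
    ring
  · filter_upwards [hlow, eventually_ge_atTop 3] with n hn hn3
    have hn0 : (0 : ℝ) < n := by exact_mod_cast (by omega : 0 < n)
    have hL : 0 < Real.log n := Real.log_pos (by exact_mod_cast (by omega : 1 < n))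
    have hupos : 0 < u n := lt_of_lt_of_le (by positivity) hn
    have hnL : 0 < (n : ℝ) ^ s * Real.log n ^ (s + 1) := by positivity
    -- The sign of `K` is not given; it follows from the lower bound, which makes `u n` positive.
    have hK : 0 < K := pos_of_mul_pos_left (hupos.trans_le (hup n hn3)) hnL.le
    rw [div_le_iff₀ hL]
    refine (Real.log_le_log hupos (hup n hn3)).trans_eq ?_
    rw [Real.log_mul hK.ne' hnL.ne', Real.log_mul (by positivity) (by positivity),
      Real.log_rpow hn0, Real.log_rpow hL]
    field_simp
    ring

end asymptotics

end

/-! ### Assembly of the two bounds -/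

theorem theorem4
    -- a `D`-dimensional Riemannian manifold, possibly with boundary or corners, with its
    -- Riemannian distance; `μHE[D]` is then the Riemannian volume
    {E : Type*} [NormedAddCommGroup E] [NormedSpace ℝ E] [FiniteDimensional ℝ E]
    {H : Type*} [TopologicalSpace H] (I : ModelWithCorners ℝ E H)
    {X : Type*} [MetricSpace X] [ChartedSpace H X] [IsManifold I 1 X]
    [Bundle.RiemannianBundle (fun x : X => TangentSpace I x)]
    [IsContinuousRiemannianBundle E (fun x : X => TangentSpace I x)]
    [IsRiemannianManifold I X]
    [MeasurableSpace X] [BorelSpace X]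
    (D : ℕ) (hD : Module.finrank ℝ E = D)
    (T : X → X) (μ : Measure X) [IsProbabilityMeasure μ] (hT : Ergodic T μ)
    (hA : ExpDecayOfCorrelations T μ) (hB : ThinAnnuli μ)
    (h : X → ℝ) (hh : Measurable h) (hh0 : ∀ x, 0 ≤ h x)
    (hμ : μ = (μHE[D] : Measure X).withDensity (fun x => ENNReal.ofReal (h x)))
    (p : X) (α k : ℝ) (hα : 0 < α) (hαD : α < D) (hk : D - α ≤ k)
    (hp : DensityComparableAt (μHE[D] : Measure X) h p α) :
    (∀ ε : ℝ, 0 < ε → ∀ᵐ x ∂μ,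
      limsup (fun n : ℕ => ((distBirkhoffSum T p k n x /
        ((n : ℝ) ^ (k / (D - α)) * Real.log n ^ (k / (D - α) + ε)) : ℝ) : EReal)) atTop = 0) ∧
    (∀ ε : ℝ, 0 < ε → ∀ᵐ x ∂μ,
      1 < liminf (fun n : ℕ => ((distBirkhoffSum T p k n x /
        ((n : ℝ) ^ (k / (D - α)) *
          Real.exp (-(Real.log n ^ (1 / 2 + ε))) ^ (k / (D - α))) : ℝ) : EReal)) atTop) ∧
    (∀ᵐ x ∂μ, Tendsto (fun n : ℕ => Real.log (distBirkhoffSum T p k n x) / Real.log n) atTop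
      (𝓝 (k / (D - α)))) := by
  have hβ : 0 < (D : ℝ) - α := sub_pos.2 hαD
  have hk0 : 0 < k := hβ.trans_le hk
  have hs : 1 ≤ k / (D - α) := (one_le_div hβ).2 hk
  have hD0 : D ≠ 0 := by
    rintro rfl
    norm_num at hαD
    linarith
  have hT' := hT.toMeasurePreserving
  obtain ⟨c, C, r₀, hc, hC, hr₀, hvol⟩ := exists_volume_ball_comparable I p
  rw [hD] at hvol
  obtain ⟨c', C', r₁, hc', hC', hr₁, hball⟩ :=
    hp.exists_measure_ball_comparable hα hαD hc hC hr₀ hvol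
  rw [← hμ] at hball
  have hμp : μ {p} = 0 := by
    rw [hμ]
    exact withDensity_absolutelyContinuous _ _
      (measure_singleton_eq_zero_of_ball_le hD0 hr₀ fun r h1 h2 ↦ (hvol r h1 h2).2)
  -- A visit to `p` itself would contribute `0` instead of a large term, so orbits meeting `p` are
  -- discarded; they form a countable union of preimages of a null set.
  have hne : ∀ᵐ x ∂μ, ∀ j : ℕ, T^[j] x ≠ p := by
    refine ae_all_iff.2 fun j ↦ ?_
    have : ∀ᵐ x ∂μ, x ≠ p := by rw [ae_iff]; simpa using hμp
    exact (hT'.iterate j).quasiMeasurePreserving.ae this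
  obtain ⟨C'', hC'', htail⟩ := exists_measure_le_dist_rpow_le (k := k) hC' hr₁ hβ hk0
    fun r h1 h2 ↦ (hball r h1 h2).2
  have hup : ∀ ε : ℝ, 0 < ε → ∀ᵐ x ∂μ, ∃ K : ℝ, ∀ n : ℕ, 3 ≤ n → distBirkhoffSum T p k n x ≤
      K * ((n : ℝ) ^ (k / (D - α)) * Real.log n ^ (k / (D - α) + ε)) := fun ε hε ↦
    hT'.ae_exists_birkhoffSum_le_of_tail (φ := fun x ↦ dist x p ^ (-k)) hs hε hC'' (by fun_prop)
      (fun x ↦ Real.rpow_nonneg dist_nonneg _) htail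
  have hlow : ∀ᵐ x ∂μ, ∀ᶠ n : ℕ in atTop,
      ((n : ℝ) / (16 * Real.log n ^ 3)) ^ (k / (D - α)) ≤ distBirkhoffSum T p k n x := by
    filter_upwards [hne, hA.ae_eventually_exists_dist_lt hT' hc' hβ hr₁
      fun r h1 h2 ↦ (hball r h1 h2).1] with x hx1 hx2
    exact eventually_le_distBirkhoffSum hβ hk0 hx1 hx2
  refine ⟨fun ε hε ↦ ?_, fun ε hε ↦ ?_, ?_⟩
  -- Using `ε / 2` here leaves a factor `(log n) ^ (-(ε / 2))` that sends the ratio to zero.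
  · filter_upwards [hup (ε / 2) (half_pos hε)] with x ⟨K, hK⟩
    exact limsup_eq_zero_of_le_rpow_log hε (fun n ↦ distBirkhoffSum_nonneg T p k n x) hK
  · filter_upwards [hlow] with x hx
    exact one_lt_liminf_of_rpow_div_log_le hs hε hx
  · filter_upwards [hlow, hup 1 one_pos] with x hx ⟨K, hK⟩
    exact tendsto_log_div_log_of_rpow_bounds hx hK
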